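/- For integers $\alpha,\beta$ let $q=e^{2\pi i\tau}$, $\operatorname{Im}\tau>0$, let $\eta(\tau)=q^{1/24}\prod_{m\ge1}(1-q^m)$, and let $a(\alpha,\beta;n)$ $(n\ge 0)$ be the coefficients of the $q$-expansion $$H_{\alpha,\beta}:=q^{-(\alpha+2\beta)/24}\,\eta(\tau)^{\alpha}\,\eta(2\tau)^{\beta}=\prod_{m\ge1}(1-q^m)^{\alpha}(1-q^{2m})^{\beta}=\sum_{n\ge0}a(\alpha,\beta;n)q^n .$$ Suppose that $\alpha+\beta\le 0$. 1. If $\alpha=0$ and $\beta\ne0$, then as $n\to\infty$ $$a(0,\beta;2n)\sim 2^{\frac{3\beta-5}{4}}\,3^{\frac{\beta-1}{4}}\,(-\beta)^{\frac{1-\beta}{4}}\,n^{\frac{\beta-3}{4}}\exp\left(\pi\sqrt{\frac{-2\beta}{3}n}\right).$$ 2. If $\alpha<0$, then as $n\to\infty$ $$a(\alpha,\beta;n)\sim 2^{\frac{2\alpha+\beta-3}{2}}\,3^{\frac{\alpha+\beta-1}{4}}\,(-(2\alpha+\beta))^{\frac{-\alpha-\beta+1}{4}}\,n^{\frac{\alpha+\beta-3}{4}}\exp\left(\pi\sqrt{\frac{-(2\alpha+\beta)}{3}n}\right).$$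 3. If $\alpha>0$, then as $n\to\infty$ $$a(\alpha,\beta;n)\sim (-1)^n\,2^{\frac{3\alpha+3\beta-7}{4}}\,3^{\frac{\alpha+\beta-1}{4}}\,(-(\alpha+2\beta))^{\frac{1-\alpha-\beta}{4}}\,n^{\frac{\alpha+\beta-3}{4}}\exp\left(\pi\sqrt{\frac{-(\alpha+2\beta)}{6}n}\right).$$ -/

import Mathlib

open Filter Asymptotics
open scoped Real UpperHalfPlane ModularForm

/-- The normalised eta quotient `H_{α,β} = q^{-(α+2β)/24} η(τ)^α η(2τ)^β` on the upper half plane,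
with `q = exp(2πiτ)`, so that `H_{α,β} = ∏_{n ≥ 1} (1 - q^n)^α (1 - q^{2n})^β`. The fractional power
of `q` is the usual `exp(2πiτ · (-(α+2β)/24))`; `η` is Mathlib's Dedekind eta function. -/
noncomputable def etaQuotientH (α β : ℤ) (τ : ℍ) : ℂ :=
  Complex.exp (2 * π * Complex.I * (τ : ℂ) * (-((α : ℂ) + 2 * β) / 24)) *
    η (τ : ℂ) ^ α * η (2 * (τ : ℂ)) ^ β

/-- `a(α,β;n)`: the coefficient of `q^n` in the `q`-expansion of `H_{α,β}`. -/
noncomputable def etaQuotientCoeff (α β : ℤ) (n : ℕ) : ℂ :=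
  (UpperHalfPlane.qExpansion 1 (etaQuotientH α β)).coeff n

open scoped Topology

/-! Write E(q) = ∏ (1 - q^m), let O(q) be its part over odd m, and let F(q) = E(q)^α E(q²)^β on the
unit disc. The proof is a circle method with a single major arc.

Case α < 0. Modular inversion of η gives E(e^{-jw}) ~ √(2π/(jw)) e^{-π²/(6jw)} as w → 0 in a sector,
hence F(e^{-w}) ~ C w^κ e^{A/w} with κ = -(α+β)/2 and A = -π²(2α+β)/12
(`tendsto_eulerProd_quotient`). In Cauchy's formula on |q| = e^{-t} the size A/t + nt is balanced at
t = √(A/n). The arc |θ| ≤ t contributes a Gaussian integral and the rest is negligible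
(`taylorCoeff_isEquivalent`), provided F is exponentially smaller there than at the positive point
of the circle.

No other root of unity needs to be examined, thanks to F(q) = O(q)^α E(q²)^(α+β). Since α+β ≤ 0, the
second factor is largest at q = |q|. In the first, each odd m saves a factor governed by |q|^m - Re
q^m. These defects sum to a geometric series, and the sum is at least a constant over t when |θ| ≥ t
(`le_oddDefect`). Restricting to odd m also separates q = 1 from q = -1, which E(q²) cannot do.

Case α > 0. The dominant point is q = -1, so the same argument is run for F(-q): now O(-q)^α is a
power of ∏ (1 + q^m), largest at q = |q|, and `eulerProd_neg` expresses E(-q) through E(q), E(q²),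
E(q⁴). The substitution produces the sign (-1)^n.

Case α = 0. F is a function of q², so the case α < 0 applies to the exponents (β, 0). -/

/-- The `n`-th Taylor coefficient of `F` at the origin. -/
noncomputable def taylorCoeff (F : ℂ → ℂ) (n : ℕ) : ℂ :=
  (n.factorial : ℂ)⁻¹ * iteratedDeriv n F 0

/-- The sector `|Im w| ≤ Re w`, `0 < Re w`. -/
def stolzSector : Set ℂ := {w | 0 < w.re ∧ |w.im| ≤ w.re}

/-! ### Saddle-point asymptotics of Taylor coefficients on the unit disc -/

theorem continuous_comp_exp_of_differentiableOn {F : ℂ → ℂ}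
    (hF : DifferentiableOn ℂ F (Metric.ball 0 1)) {g : ℝ → ℂ} (hg : Continuous g)
    (hre : ∀ x, (g x).re < 0) : Continuous fun x => F (Complex.exp (g x)) := by
  have : Continuous fun x => Complex.exp (g x) := Complex.continuous_exp.comp hg
  refine hF.continuousOn.comp_continuous this fun x => ?_
  simpa [Complex.norm_exp] using hre x

theorem periodic_circle_integrand (F : ℂ → ℂ) (n : ℕ) (t : ℝ) :
    Function.Periodic (fun θ : ℝ =>
      F (Complex.exp (-t + θ * Complex.I)) * Complex.exp (n * (t - θ * Complex.I))) (2 * π) := by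
  intro θ
  have h1 : Complex.exp (-t + (θ + 2 * π : ℝ) * Complex.I)
      = Complex.exp (-t + θ * Complex.I) := by
    rw [Complex.exp_eq_exp_iff_exists_int]
    exact ⟨1, by push_cast; ring⟩
  have h2 : Complex.exp (n * (t - (θ + 2 * π : ℝ) * Complex.I))
      = Complex.exp (n * (t - θ * Complex.I)) := by
    rw [Complex.exp_eq_exp_iff_exists_int]
    exact ⟨-n, by push_cast; ring⟩
  simp only [h1, h2]

/-- Cauchy's formula on the circle of radius e^{-t}. Every t > 0 is allowed, so t may later depend
on n. -/
theorem taylorCoeff_eq_integral {F : ℂ → ℂ} (hF : DifferentiableOn ℂ F (Metric.ball 0 1))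
    (n : ℕ) {t : ℝ} (ht : 0 < t) :
    taylorCoeff F n = (2 * π : ℂ)⁻¹ * ∫ θ in (-π)..π,
      F (Complex.exp (-t + θ * Complex.I)) * Complex.exp (n * (t - θ * Complex.I)) := by
  have hR : 0 < Real.exp (-t) := Real.exp_pos _
  have hR1 : Real.exp (-t) < 1 := by simpa using ht
  have h := (hF.mono (Metric.closedBall_subset_ball hR1)).circleIntegral_one_div_sub_center_pow_smul
    hR n
  have hper := periodic_circle_integrand F n t
  have hshift := hper.intervalIntegral_add_eq (-π) 0
  rw [show -π + 2 * π = π by ring, zero_add] at hshift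
  rw [hshift]
  have hI : (∮ z in C(0, Real.exp (-t)), (1 / (z - 0) ^ (n + 1)) • F z) =
      Complex.I * ∫ θ in (0 : ℝ)..(2 * π),
        F (Complex.exp (-t + θ * Complex.I)) * Complex.exp (n * (t - θ * Complex.I)) := by
    rw [circleIntegral, ← intervalIntegral.integral_const_mul]
    refine intervalIntegral.integral_congr fun θ _ => ?_
    have h0 : circleMap 0 (Real.exp (-t)) θ = Complex.exp (-t + θ * Complex.I) := by
      simp [circleMap, Complex.exp_add]
    have h3 : Complex.exp (n * (t - θ * Complex.I))
        = (Complex.exp (-t + θ * Complex.I) ^ n)⁻¹ := by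
      rw [← Complex.exp_nat_mul, ← Complex.exp_neg]
      congr 1; ring
    have h4 : Complex.exp (-t + θ * Complex.I) ≠ 0 := Complex.exp_ne_zero _
    simp only [deriv_circleMap, h0, h3, sub_zero, smul_eq_mul]
    field_simp
    ring
  rw [hI] at h
  rw [taylorCoeff]
  have hpi : (π : ℂ) ≠ 0 := by exact_mod_cast Real.pi_ne_zero
  have hfac : (n.factorial : ℂ) ≠ 0 := by exact_mod_cast n.factorial_ne_zero
  simp only [smul_eq_mul] at h
  have h5 := mul_left_cancel₀ Complex.I_ne_zero
    (h.trans (show _ = Complex.I * (2 * π / n.factorial * iteratedDeriv n F 0) by ring))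
  rw [h5]
  field_simp

theorem integral_cexp_neg_sq : ∫ s : ℝ, Complex.exp (-(s : ℂ) ^ 2) = (√π : ℝ) := by
  have h := integral_gaussian 1
  rw [div_one] at h
  rw [← h, ← integral_complex_ofReal]
  refine MeasureTheory.integral_congr_ae (.of_forall fun s => ?_)
  simp

theorem one_sub_mul_I_re_pos (y : ℝ) : 0 < (1 - (y : ℂ) * Complex.I).re := by simp

theorem one_sub_mul_I_ne_zero (y : ℝ) : (1 - (y : ℂ) * Complex.I) ≠ 0 := by
  intro h
  simpa [h] using one_sub_mul_I_re_pos y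

theorem neg_sq_div_one_sub_mul_I_re (N y : ℝ) :
    (-(N * y ^ 2) / (1 - (y : ℂ) * Complex.I) : ℂ).re = -(N * y ^ 2) / (1 + y ^ 2) := by
  have : (-(N * y ^ 2) : ℂ) = ((-(N * y ^ 2) : ℝ) : ℂ) := by push_cast; ring
  rw [this, Complex.div_re, Complex.ofReal_re, Complex.ofReal_im]
  simp [Complex.normSq_apply]
  ring

/-- The integrand on the major arc, after factoring out the size at the saddle point. -/
theorem majorArc_integrand_eq {F : ℂ → ℂ} {A κ N : ℝ} (hA : 0 < A) (hN : 0 < N) (y : ℝ) :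
    F (Complex.exp (-((A / N : ℝ) * (1 - y * Complex.I)))) * Complex.exp (N * (1 - y * Complex.I))
        * (((A / N) ^ (-κ) * Real.exp (-2 * N) : ℝ) : ℂ) =
      F (Complex.exp (-((A / N : ℝ) * (1 - y * Complex.I)))) /
        (((A / N : ℝ) * (1 - y * Complex.I)) ^ (κ : ℂ) *
          Complex.exp (A / ((A / N : ℝ) * (1 - y * Complex.I)))) *
      (1 - y * Complex.I) ^ (κ : ℂ) *
      Complex.exp (-(N * y ^ 2) / (1 - y * Complex.I)) := by
  have hne := one_sub_mul_I_ne_zero y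
  have ht : 0 < A / N := by positivity
  have hcpow : (((A / N : ℝ) : ℂ) * (1 - y * Complex.I)) ^ (κ : ℂ) =
      (((A / N) ^ κ : ℝ) : ℂ) * (1 - y * Complex.I) ^ (κ : ℂ) := by
    have h1 : (((A / N : ℝ) : ℂ)) ≠ 0 := by exact_mod_cast ht.ne'
    rw [Complex.cpow_def_of_ne_zero (mul_ne_zero h1 hne), Complex.log_ofReal_mul ht hne,
      Complex.cpow_def_of_ne_zero hne, Real.rpow_def_of_pos ht, add_mul, Complex.exp_add]
    push_cast
    rfl
  have h2 : (1 - y * Complex.I : ℂ) ^ (κ : ℂ) ≠ 0 := by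
    rw [Complex.cpow_def_of_ne_zero hne]; exact Complex.exp_ne_zero _
  -- With x = 1 - iy, the exponent is governed by x + 1/x - 2 = (1 - x)²/x = -y²/(1 - iy).
  have hexp : Complex.exp (N * (1 - y * Complex.I)) * (Real.exp (-2 * N) : ℝ) =
      Complex.exp (-(N * y ^ 2) / (1 - y * Complex.I)) /
        Complex.exp (A / ((A / N : ℝ) * (1 - y * Complex.I))) := by
    rw [Complex.ofReal_exp, ← Complex.exp_add, ← Complex.exp_sub]
    congr 1
    have hN' : (N : ℂ) ≠ 0 := by exact_mod_cast hN.ne'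
    have hA' : (A : ℂ) ≠ 0 := by exact_mod_cast hA.ne'
    push_cast
    field_simp
    ring_nf
    simp only [Complex.I_sq]
    ring
  rw [hcpow, Real.rpow_neg ht.le, Complex.ofReal_mul]
  have h3 : (((A / N) ^ κ : ℝ) : ℂ) ≠ 0 := by
    exact_mod_cast (Real.rpow_pos_of_pos ht κ).ne'
  calc _ = F (Complex.exp (-((A / N : ℝ) * (1 - y * Complex.I)))) *
        (((A / N) ^ κ : ℝ) : ℂ)⁻¹ *
        (Complex.exp (N * (1 - y * Complex.I)) * (Real.exp (-2 * N) : ℝ)) := by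
        push_cast; ring
    _ = _ := by
        rw [hexp]
        have h4 := Complex.exp_ne_zero (A / ((A / N : ℝ) * (1 - y * Complex.I)))
        field_simp

/-- Laplace's method: after y = s/√N the normalised integrand tends pointwise to C e^{-s²}, and
dominated convergence applies. The range |y| ≤ 1 is exactly what keeps w = (A/N)(1 - iy) in
`stolzSector`. -/
theorem tendsto_majorArc_integral {F : ℂ → ℂ} (hF : DifferentiableOn ℂ F (Metric.ball 0 1))
    {A κ : ℝ} {C : ℂ} (hA : 0 < A)
    (hmaj : Tendsto (fun w : ℂ => F (Complex.exp (-w)) / (w ^ (κ : ℂ) * Complex.exp (A / w)))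
      (𝓝[stolzSector] 0) (𝓝 C)) :
    Tendsto (fun N : ℝ => ((√N : ℝ) : ℂ) * ∫ y in (-1 : ℝ)..1,
      F (Complex.exp (-((A / N : ℝ) * (1 - y * Complex.I)))) * Complex.exp (N * (1 - y * Complex.I))
        * (((A / N) ^ (-κ) * Real.exp (-2 * N) : ℝ) : ℂ)) atTop (𝓝 (C * (√π : ℝ))) := by
  set f : ℝ → ℝ → ℂ := fun N y =>
    F (Complex.exp (-((A / N : ℝ) * (1 - y * Complex.I)))) * Complex.exp (N * (1 - y * Complex.I))
        * (((A / N) ^ (-κ) * Real.exp (-2 * N) : ℝ) : ℂ) with hf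
  set g : ℂ → ℂ := fun w => F (Complex.exp (-w)) / (w ^ (κ : ℂ) * Complex.exp (A / w)) with hg
  have hfcont : ∀ N : ℝ, 0 < N → Continuous (f N) := by
    intro N hN
    have h1 : Continuous fun y : ℝ =>
        F (Complex.exp (-((A / N : ℝ) * (1 - y * Complex.I)))) := by
      refine continuous_comp_exp_of_differentiableOn hF (by fun_prop) fun y => ?_
      have : 0 < A / N := by positivity
      simp only [Complex.neg_re, Complex.re_ofReal_mul]
      have := one_sub_mul_I_re_pos y
      nlinarith
    exact (h1.mul (by fun_prop)).mul continuous_const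
  have hfg : ∀ N : ℝ, 0 < N → ∀ y : ℝ, f N y = g ((A / N : ℝ) * (1 - y * Complex.I)) *
      (1 - y * Complex.I) ^ (κ : ℂ) * Complex.exp (-(N * y ^ 2) / (1 - y * Complex.I)) :=
    fun N hN y => majorArc_integrand_eq hA hN y
  have hsector : ∀ N : ℝ, 0 < N → ∀ y : ℝ, |y| ≤ 1 →
      ((A / N : ℝ) : ℂ) * (1 - y * Complex.I) ∈ stolzSector := by
    intro N hN y hy
    have : 0 < A / N := by positivity
    refine ⟨?_, ?_⟩
    · rw [Complex.re_ofReal_mul]; have := one_sub_mul_I_re_pos y; positivity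
    · rw [Complex.re_ofReal_mul, Complex.im_ofReal_mul, abs_mul, abs_of_pos this]
      simpa using mul_le_mul_of_nonneg_left hy this.le
  obtain ⟨K, hK⟩ : ∃ K, ∀ y ∈ Set.Icc (-1 : ℝ) 1, ‖(1 - y * Complex.I : ℂ) ^ (κ : ℂ)‖ ≤ K := by
    refine isCompact_Icc.exists_bound_of_continuousOn (Continuous.continuousOn ?_)
    refine Continuous.cpow (by fun_prop) continuous_const fun y => ?_
    exact Or.inl (one_sub_mul_I_re_pos y)
  have hK0 : 0 ≤ K := (norm_nonneg _).trans (hK 0 (by norm_num))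
  -- The rescaled integrand, extended by zero so that the domain no longer depends on N.
  set Φ : ℝ → ℝ → ℂ := fun N =>
    (Set.Ioc (-√N) (√N)).indicator fun s => f N (s / √N) with hΦ
  have hint : ∀ᶠ N : ℝ in atTop, ∫ s, Φ N s = ((√N : ℝ) : ℂ) * ∫ y in (-1 : ℝ)..1, f N y := by
    filter_upwards [eventually_gt_atTop 0] with N hN
    have hs : 0 < √N := Real.sqrt_pos.2 hN
    rw [hΦ, MeasureTheory.integral_indicator measurableSet_Ioc,
      ← intervalIntegral.integral_of_le (by linarith), intervalIntegral.integral_comp_div _ hs.ne',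
      neg_div, div_self hs.ne', Complex.real_smul]
  refine Tendsto.congr' hint ?_
  have hlim : C * (√π : ℝ) = ∫ s : ℝ, C * Complex.exp (-(s : ℂ) ^ 2) := by
    rw [MeasureTheory.integral_const_mul, integral_cexp_neg_sq]
  rw [hlim]
  refine MeasureTheory.tendsto_integral_filter_of_dominated_convergence
    -- The rate 1/2 comes from y² ≤ 1: Ny²/(1 + y²) ≥ s²/2 when s = y√N.
    (fun s => (‖C‖ + 1) * K * Real.exp (-(1 / 2) * s ^ 2)) ?_ ?_ ?_ ?_
  · filter_upwards [eventually_gt_atTop 0] with N hN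
    exact (((hfcont N hN).comp (continuous_id.div_const _)).aestronglyMeasurable).indicator
      measurableSet_Ioc
  · have hev : ∀ᶠ w in 𝓝[stolzSector] 0, ‖g w‖ < ‖C‖ + 1 :=
      hmaj.norm.eventually_lt_const (by linarith)
    rw [eventually_nhdsWithin_iff, Metric.eventually_nhds_iff] at hev
    obtain ⟨ε, hε, hev⟩ := hev
    -- Since |1 - iy| ≤ 2, the condition N > 2A/ε puts w within ε of 0.
    filter_upwards [eventually_gt_atTop 0, eventually_gt_atTop (2 * A / ε)] with N hN hN2
    refine .of_forall fun s => ?_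
    have hs : 0 < √N := Real.sqrt_pos.2 hN
    simp only [hΦ]
    by_cases hmem : s ∈ Set.Ioc (-√N) (√N)
    · rw [Set.indicator_of_mem hmem]
      have hy : |s / √N| ≤ 1 := by
        rw [abs_div, abs_of_pos hs, div_le_one hs, abs_le]
        exact ⟨hmem.1.le, hmem.2⟩
      rw [hfg N hN, norm_mul, norm_mul]
      gcongr
      · refine (hev ?_ (hsector N hN _ hy)).le
        rw [dist_zero_right, norm_mul, Complex.norm_real, Real.norm_of_nonneg (by positivity)]
        have h1 : ‖(1 - (s / √N : ℝ) * Complex.I : ℂ)‖ ≤ 2 := by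
          refine (norm_sub_le _ _).trans ?_
          rw [norm_mul, Complex.norm_real, Complex.norm_I, norm_one, Real.norm_eq_abs]
          linarith
        calc A / N * _ ≤ A / N * 2 := by gcongr
          _ < ε := by
            rw [div_lt_iff₀ hε] at hN2
            rw [div_mul_eq_mul_div, div_lt_iff₀ hN]
            linarith
      · exact hK _ (abs_le.1 hy)
      · rw [Complex.norm_exp, Real.exp_le_exp, neg_sq_div_one_sub_mul_I_re]
        have h2 : (s / √N) ^ 2 ≤ 1 := (sq_le_one_iff_abs_le_one _).2 hy
        have h3 : N * (s / √N) ^ 2 = s ^ 2 := by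
          rw [div_pow, Real.sq_sqrt hN.le]; field_simp
        rw [h3, div_le_iff₀ (by positivity)]
        nlinarith [sq_nonneg s]
    · rw [Set.indicator_of_notMem hmem, norm_zero]
      positivity
  · exact (integrable_exp_neg_mul_sq (by norm_num)).const_mul _
  · refine .of_forall fun s => ?_
    have hsq : Tendsto (fun N : ℝ => √N) atTop atTop := Real.tendsto_sqrt_atTop
    have hy0 : Tendsto (fun N : ℝ => s / √N) atTop (𝓝 0) := hsq.const_div_atTop s
    have hz : Tendsto (fun N : ℝ => (1 - (s / √N : ℝ) * Complex.I : ℂ)) atTop (𝓝 1) := by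
      have := (((Complex.continuous_ofReal.tendsto 0).comp hy0).mul_const Complex.I).const_sub 1
      simpa using this
    have hmem : ∀ᶠ N : ℝ in atTop, 0 < N ∧ |s| < √N :=
      (eventually_gt_atTop 0).and (hsq.eventually_gt_atTop |s|)
    have hw : Tendsto (fun N : ℝ => ((A / N : ℝ) : ℂ) * (1 - (s / √N : ℝ) * Complex.I)) atTop
        (𝓝[stolzSector] 0) := by
      refine tendsto_nhdsWithin_iff.2 ⟨?_, ?_⟩
      · have h1 : Tendsto (fun N : ℝ => A / N) atTop (𝓝 0) := tendsto_id.const_div_atTop A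
        simpa using ((Complex.continuous_ofReal.tendsto 0).comp h1).mul hz
      · filter_upwards [hmem] with N hN
        refine hsector N hN.1 _ ?_
        have hs : 0 < √N := Real.sqrt_pos.2 hN.1
        rw [abs_div, abs_of_pos hs, div_le_one hs]
        exact hN.2.le
    have hprod : Tendsto (fun N : ℝ => g (((A / N : ℝ) : ℂ) * (1 - (s / √N : ℝ) * Complex.I)) *
        (1 - (s / √N : ℝ) * Complex.I : ℂ) ^ (κ : ℂ) *
        Complex.exp (-(s : ℂ) ^ 2 / (1 - (s / √N : ℝ) * Complex.I))) atTop
        (𝓝 (C * 1 ^ (κ : ℂ) * Complex.exp (-(s : ℂ) ^ 2 / 1))) := by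
      refine ((hmaj.comp hw).mul (hz.cpow tendsto_const_nhds ?_)).mul ?_
      · exact Complex.one_mem_slitPlane
      · exact (Complex.continuous_exp.tendsto _).comp (tendsto_const_nhds.div hz one_ne_zero)
    rw [Complex.one_cpow, mul_one, div_one] at hprod
    refine hprod.congr' ?_
    filter_upwards [hmem] with N hN
    have hs := abs_lt.1 hN.2
    simp only [hΦ]
    rw [Set.indicator_of_mem (show s ∈ Set.Ioc (-√N) (√N) from ⟨hs.1, hs.2.le⟩), hfg N hN.1]
    congr 3
    have h3 : N * (s / √N) ^ 2 = s ^ 2 := by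
      rw [div_pow, Real.sq_sqrt hN.1.le]; have := hN.1.ne'; field_simp
    exact_mod_cast congrArg (fun x : ℝ => -(x : ℂ)) h3.symm

/-- A bound on one of the two minor arcs, in terms of the size at the real point of the circle. -/
theorem norm_minorArc_integral_le {F : ℂ → ℂ} {t B a b : ℝ} {n : ℕ}
    (hB : ∀ θ ∈ Set.uIoc a b, ‖F (Complex.exp (-t + θ * Complex.I))‖ ≤ B) (hab : |b - a| ≤ π)
    (hB0 : 0 ≤ B) :
    ‖∫ θ in a..b, F (Complex.exp (-t + θ * Complex.I)) *
      Complex.exp (n * (t - θ * Complex.I))‖ ≤ π * (B * Real.exp (n * t)) := by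
  refine (intervalIntegral.norm_integral_le_of_norm_le_const
    (C := B * Real.exp (n * t)) fun θ hθ => ?_).trans ?_
  · rw [norm_mul, Complex.norm_exp]
    have : ((n : ℂ) * (t - θ * Complex.I)).re = n * t := by simp
    rw [this]
    exact mul_le_mul_of_nonneg_right (hB θ hθ) (Real.exp_pos _).le
  · rw [mul_comm]
    gcongr

/-- With N = √(An) and t = A/N one has nt = A/t = N, so the integrand has size about t^κ e^{2N} at θ
= 0. The substitution θ = ty turns |θ| ≤ t into the major arc integral; `hmin` makes the two
remaining arcs smaller by e^{-c/t}. -/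
theorem tendsto_taylorCoeff_mul {F : ℂ → ℂ} (hF : DifferentiableOn ℂ F (Metric.ball 0 1))
    {A κ : ℝ} {C : ℂ} (hA : 0 < A)
    (hmaj : Tendsto (fun w : ℂ => F (Complex.exp (-w)) / (w ^ (κ : ℂ) * Complex.exp (A / w)))
      (𝓝[stolzSector] 0) (𝓝 C))
    (hmin : ∃ c > 0, ∀ᶠ t : ℝ in 𝓝[>] 0, ∀ θ : ℝ, t ≤ |θ| → |θ| ≤ π →
      ‖F (Complex.exp (-t + θ * Complex.I))‖ ≤ ‖F (Complex.exp (-t))‖ * Real.exp (-c / t)) :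
    Tendsto (fun n : ℕ => taylorCoeff F n *
      ((√(√(A * n)) * ((A / √(A * n)) ^ (-κ) * Real.exp (-2 * √(A * n))) / (A / √(A * n)) : ℝ) : ℂ))
      atTop (𝓝 ((2 * π : ℂ)⁻¹ * (C * (√π : ℝ)))) := by
  obtain ⟨c, hc, hmin⟩ := hmin
  have hN : Tendsto (fun n : ℕ => √(A * n)) atTop atTop :=
    Real.tendsto_sqrt_atTop.comp (tendsto_natCast_atTop_atTop.const_mul_atTop hA)
  have ht : Tendsto (fun n : ℕ => A / √(A * n)) atTop (𝓝[>] 0) := by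
    refine tendsto_nhdsWithin_iff.2 ⟨hN.const_div_atTop A, ?_⟩
    filter_upwards [hN.eventually_gt_atTop 0] with n hn
    exact div_pos hA hn
  have hsec : Tendsto (fun t : ℝ => (t : ℂ)) (𝓝[>] 0) (𝓝[stolzSector] 0) := by
    refine tendsto_nhdsWithin_iff.2 ⟨?_, ?_⟩
    · exact (Complex.continuous_ofReal.tendsto' 0 0 (by simp)).mono_left nhdsWithin_le_nhds
    · filter_upwards [self_mem_nhdsWithin] with t ht
      have ht : 0 < t := ht
      exact ⟨by simpa using ht, by simpa using ht.le⟩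
  have hreal : ∀ᶠ t : ℝ in 𝓝[>] 0,
      ‖F (Complex.exp (-t))‖ ≤ (‖C‖ + 1) * (t ^ κ * Real.exp (A / t)) := by
    have h1 : ∀ᶠ t : ℝ in 𝓝[>] 0, _ :=
      (hmaj.comp hsec).norm.eventually_lt_const (show ‖C‖ < ‖C‖ + 1 by linarith)
    filter_upwards [h1, self_mem_nhdsWithin] with t h1 ht
    have ht : 0 < t := ht
    have h2 : ‖(t : ℂ) ^ (κ : ℂ) * Complex.exp (A / t)‖ = t ^ κ * Real.exp (A / t) := by
      rw [norm_mul, Complex.norm_cpow_eq_rpow_re_of_pos ht, Complex.norm_exp, Complex.ofReal_re]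
      norm_cast
    have h3 : 0 < t ^ κ * Real.exp (A / t) := by positivity
    simp only [Function.comp_apply, norm_div, h2] at h1
    rw [div_lt_iff₀ h3] at h1
    exact h1.le
  set f : ℝ → ℝ → ℂ := fun N y =>
    F (Complex.exp (-((A / N : ℝ) * (1 - y * Complex.I)))) * Complex.exp (N * (1 - y * Complex.I))
        * (((A / N) ^ (-κ) * Real.exp (-2 * N) : ℝ) : ℂ) with hf
  have hmain : Tendsto (fun n : ℕ => ((√(√(A * n)) : ℝ) : ℂ) * ∫ y in (-1 : ℝ)..1, f (√(A * n)) y)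
      atTop (𝓝 (C * (√π : ℝ))) := (tendsto_majorArc_integral hF hA hmaj).comp hN
  have hkey := (show Tendsto (fun n : ℕ => (2 * π : ℂ)⁻¹ * (taylorCoeff F n *
      ((√(√(A * n)) * ((A / √(A * n)) ^ (-κ) * Real.exp (-2 * √(A * n))) / (A / √(A * n)) : ℝ) : ℂ)
      * (2 * π) - ((√(√(A * n)) : ℝ) : ℂ) * ∫ y in (-1 : ℝ)..1, f (√(A * n)) y)) atTop
      (𝓝 ((2 * π : ℂ)⁻¹ * 0)) from ?_).add (hmain.const_mul (2 * π : ℂ)⁻¹)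
  · rw [mul_zero, zero_add] at hkey
    refine hkey.congr fun n => ?_
    have hpi : (π : ℂ) ≠ 0 := by exact_mod_cast Real.pi_ne_zero
    field_simp
    ring
  refine Tendsto.const_mul _ ?_
  -- Two arcs of length at most π give 2π; √N/t = N^(3/2)/A and c/t = (c/A)N give the rest.
  have hdecay : Tendsto (fun n : ℕ => 2 * π * (‖C‖ + 1) / A *
      (√(A * n) ^ (3 / 2 : ℝ) * Real.exp (-(c / A) * √(A * n)))) atTop (𝓝 0) := by
    simpa using ((tendsto_rpow_mul_exp_neg_mul_atTop_nhds_zero (3 / 2) (c / A)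
      (by positivity)).comp hN).const_mul (2 * π * (‖C‖ + 1) / A)
  refine squeeze_zero_norm' ?_ hdecay
  filter_upwards [hN.eventually_gt_atTop 0, ht.eventually hmin, ht.eventually hreal,
    (hN.const_div_atTop A).eventually_lt_const Real.pi_pos] with n hn hmin hreal htpi
  set N : ℝ := √(A * n) with hNdef
  set t : ℝ := A / N with htdef
  have ht0 : 0 < t := by positivity
  have hnt : n * t = N := by
    have : N * N = A * n := Real.mul_self_sqrt (by positivity)
    rw [htdef, ← mul_div_assoc, div_eq_iff hn.ne', this]; ring
  set G : ℝ → ℂ := fun θ =>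
    F (Complex.exp (-t + θ * Complex.I)) * Complex.exp (n * (t - θ * Complex.I)) with hG
  have hGcont : Continuous G := by
    have h1 : Continuous fun θ : ℝ => F (Complex.exp (-t + θ * Complex.I)) :=
      continuous_comp_exp_of_differentiableOn hF (by fun_prop) fun x => by simpa using ht0
    exact h1.mul (by fun_prop)
  have hint : ∀ a b, IntervalIntegrable G MeasureTheory.volume a b :=
    fun a b => hGcont.intervalIntegrable a b
  have hsplit : ∫ θ in (-π)..π, G θ =
      (∫ θ in (-π)..(-t), G θ) + (∫ θ in (-t)..t, G θ) + ∫ θ in t..π, G θ := by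
    rw [intervalIntegral.integral_add_adjacent_intervals (hint _ _) (hint _ _),
      intervalIntegral.integral_add_adjacent_intervals (hint _ _) (hint _ _)]
  have hmid : (∫ θ in (-t)..t, G θ) * (((t ^ (-κ) * Real.exp (-2 * N) : ℝ)) : ℂ) =
      t * ∫ y in (-1 : ℝ)..1, f N y := by
    have h1 : ∫ y in (-1 : ℝ)..1, G (y * t) = t⁻¹ • ∫ θ in (-t)..t, G θ := by
      rw [intervalIntegral.integral_comp_mul_right _ ht0.ne', neg_one_mul, one_mul]
    have h2 : ∀ y : ℝ, f N y = G (y * t) * (((t ^ (-κ) * Real.exp (-2 * N) : ℝ)) : ℂ) := by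
      intro y
      simp only [hf, hG]
      have e1 : -((t : ℂ) * (1 - y * Complex.I)) = -t + (y * t : ℝ) * Complex.I := by
        push_cast; ring
      have e2 : (N : ℂ) * (1 - y * Complex.I) = n * (t - (y * t : ℝ) * Complex.I) := by
        rw [← hnt]; push_cast; ring
      rw [← e1, ← e2]
    simp_rw [h2]
    rw [intervalIntegral.integral_mul_const, h1, Complex.real_smul]
    have : (t : ℂ) ≠ 0 := by exact_mod_cast ht0.ne'
    push_cast
    field_simp
  set B : ℝ := ‖F (Complex.exp (-t))‖ * Real.exp (-c / t) with hB
  have hB0 : 0 ≤ B := by positivity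
  have hm1 : ‖∫ θ in (-π)..(-t), G θ‖ ≤ π * (B * Real.exp (n * t)) := by
    refine norm_minorArc_integral_le (fun θ hθ => ?_) ?_ hB0
    · rw [Set.uIoc_of_le (by linarith)] at hθ
      have h1 : |θ| = -θ := abs_of_nonpos (by linarith [hθ.2])
      exact hmin θ (by rw [h1]; linarith [hθ.2]) (by rw [h1]; linarith [hθ.1])
    · rw [abs_of_nonneg] <;> linarith
  have hm2 : ‖∫ θ in t..π, G θ‖ ≤ π * (B * Real.exp (n * t)) := by
    refine norm_minorArc_integral_le (fun θ hθ => ?_) ?_ hB0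
    · rw [Set.uIoc_of_le (by linarith)] at hθ
      have h1 : |θ| = θ := abs_of_nonneg (by linarith [hθ.1])
      exact hmin θ (by rw [h1]; linarith [hθ.1]) (by rw [h1]; linarith [hθ.2])
    · rw [abs_of_nonneg] <;> linarith
  have hdiff : taylorCoeff F n * ((√N * (t ^ (-κ) * Real.exp (-2 * N)) / t : ℝ) : ℂ) * (2 * π) -
      ((√N : ℝ) : ℂ) * ∫ y in (-1 : ℝ)..1, f N y =
      ((∫ θ in (-π)..(-t), G θ) + ∫ θ in t..π, G θ) *
        ((√N * (t ^ (-κ) * Real.exp (-2 * N)) / t : ℝ) : ℂ) := by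
    have hpi : (π : ℂ) ≠ 0 := by exact_mod_cast Real.pi_ne_zero
    have htne : (t : ℂ) ≠ 0 := by exact_mod_cast ht0.ne'
    have h1 : ∫ y in (-1 : ℝ)..1, f N y =
        (∫ θ in (-t)..t, G θ) * (((t ^ (-κ) * Real.exp (-2 * N) : ℝ)) : ℂ) / t := by
      rw [hmid]; field_simp
    rw [taylorCoeff_eq_integral hF n ht0, hsplit, h1]
    push_cast
    field_simp
    ring
  rw [hdiff, norm_mul, Complex.norm_real, Real.norm_of_nonneg (by positivity)]
  have hsum := (norm_add_le (∫ θ in (-π)..(-t), G θ) (∫ θ in t..π, G θ)).trans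
    (add_le_add hm1 hm2)
  have hBle : B ≤ (‖C‖ + 1) * (t ^ κ * Real.exp N) * Real.exp (-(c / A) * N) := by
    have e1 : A / t = N := by rw [htdef]; field_simp
    have e2 : -c / t = -(c / A) * N := by rw [htdef]; field_simp
    rw [e1] at hreal
    rw [hB, e2]
    gcongr
  calc _ ≤ (2 * (π * (((‖C‖ + 1) * (t ^ κ * Real.exp N) * Real.exp (-(c / A) * N)) *
        Real.exp N))) * (√N * (t ^ (-κ) * Real.exp (-2 * N)) / t) := by
        gcongr
        refine hsum.trans ?_
        rw [← two_mul, hnt]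
        gcongr
    _ = _ := by
      have e3 : t ^ (-κ) = (t ^ κ)⁻¹ := Real.rpow_neg ht0.le κ
      have e4 : Real.exp (-2 * N) = (Real.exp N)⁻¹ * (Real.exp N)⁻¹ := by
        rw [← Real.exp_neg, ← Real.exp_add]; ring_nf
      have e5 : N ^ (3 / 2 : ℝ) = N * √N := by
        rw [show (3 / 2 : ℝ) = 1 + 1 / 2 by norm_num, Real.rpow_add hn, Real.rpow_one,
          Real.sqrt_eq_rpow]
      have h6 : 0 < t ^ κ := by positivity
      have h7 := Real.exp_pos N
      rw [e3, e4, e5]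
      field_simp
      rw [htdef]
      field_simp

/-- Asymptotics of the Taylor coefficients of a function on the unit disc with a dominant
singularity of the type `C w ^ κ exp (A / w)` at the point `exp (-w) = 1`. -/
theorem taylorCoeff_isEquivalent {F : ℂ → ℂ} (hF : DifferentiableOn ℂ F (Metric.ball 0 1))
    {A κ : ℝ} {C : ℂ} (hA : 0 < A) (hC : C ≠ 0)
    (hmaj : Tendsto (fun w : ℂ => F (Complex.exp (-w)) / (w ^ (κ : ℂ) * Complex.exp (A / w)))
      (𝓝[stolzSector] 0) (𝓝 C))
    (hmin : ∃ c > 0, ∀ᶠ t : ℝ in 𝓝[>] 0, ∀ θ : ℝ, t ≤ |θ| → |θ| ≤ π →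
      ‖F (Complex.exp (-t + θ * Complex.I))‖ ≤ ‖F (Complex.exp (-t))‖ * Real.exp (-c / t)) :
    (fun n : ℕ => taylorCoeff F n) ~[atTop] fun n : ℕ =>
      C * (((2 * √π)⁻¹ * A ^ (κ / 2 + 1 / 4) * (n : ℝ) ^ (-κ / 2 - 3 / 4) *
        Real.exp (2 * √(A * n)) : ℝ) : ℂ) := by
  have h := tendsto_taylorCoeff_mul hF hA hmaj hmin
  have hpi : 0 < √π := Real.sqrt_pos.2 Real.pi_pos
  have hpos : ∀ n : ℕ, 0 < n → 0 < (2 * √π)⁻¹ * A ^ (κ / 2 + 1 / 4) *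
      (n : ℝ) ^ (-κ / 2 - 3 / 4) * Real.exp (2 * √(A * n)) := by
    intro n hn
    positivity
  refine (isEquivalent_iff_tendsto_one ?_).2 ?_
  · filter_upwards [eventually_gt_atTop 0] with n hn
    exact mul_ne_zero hC (by exact_mod_cast (hpos n hn).ne')
  have hlim : (2 * π : ℂ)⁻¹ * (C * (√π : ℝ)) ≠ 0 := by
    have : (π : ℂ) ≠ 0 := by exact_mod_cast Real.pi_ne_zero
    have h2 : ((√π : ℝ) : ℂ) ≠ 0 := by exact_mod_cast hpi.ne'
    exact mul_ne_zero (inv_ne_zero (mul_ne_zero two_ne_zero this)) (mul_ne_zero hC h2)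
  have h1 := h.div_const ((2 * π : ℂ)⁻¹ * (C * (√π : ℝ)))
  rw [div_self hlim] at h1
  refine h1.congr' ?_
  filter_upwards [eventually_gt_atTop 0] with n hn
  -- Here (2√π)⁻¹ = √π/(2π) is the Gaussian constant. Apart from it, the normalising factor and the
  -- claimed main term are reciprocal, which becomes linear algebra in log A and log n.
  have hid : √(√(A * n)) * ((A / √(A * n)) ^ (-κ) * Real.exp (-2 * √(A * n))) / (A / √(A * n)) *
      ((2 * √π)⁻¹ * A ^ (κ / 2 + 1 / 4) * (n : ℝ) ^ (-κ / 2 - 3 / 4) *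
        Real.exp (2 * √(A * n))) = (2 * √π)⁻¹ := by
    have hn' : (0 : ℝ) < n := by exact_mod_cast hn
    have e1 : Real.exp (-2 * √(A * n)) * Real.exp (2 * √(A * n)) = 1 := by
      rw [← Real.exp_add]; simp
    have e2 : √(√(A * n)) * (A / √(A * n)) ^ (-κ) / (A / √(A * n)) *
        (A ^ (κ / 2 + 1 / 4) * (n : ℝ) ^ (-κ / 2 - 3 / 4)) = 1 := by
      have hA' := Real.exp_log hA
      have hn'' := Real.exp_log hn'
      have hs : √(A * n) = Real.exp ((Real.log A + Real.log n) / 2) := by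
        rw [Real.exp_half, Real.exp_add, hA', hn'']
      have ht : A / √(A * n) = Real.exp (Real.log A - (Real.log A + Real.log n) / 2) := by
        rw [Real.exp_sub, hA', hs]
      rw [ht, hs, ← Real.exp_half, Real.rpow_def_of_pos hA, Real.rpow_def_of_pos hn', ← Real.exp_mul,
        ← Real.exp_add, ← Real.exp_sub, ← Real.exp_add, ← Real.exp_add, Real.exp_eq_one_iff]
      ring
    calc _ = (2 * √π)⁻¹ * (Real.exp (-2 * √(A * n)) * Real.exp (2 * √(A * n))) *
        (√(√(A * n)) * (A / √(A * n)) ^ (-κ) / (A / √(A * n)) *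
        (A ^ (κ / 2 + 1 / 4) * (n : ℝ) ^ (-κ / 2 - 3 / 4))) := by ring
      _ = _ := by rw [e1, e2, mul_one, mul_one]
  have hsq : (√π : ℝ) * √π = π := Real.mul_self_sqrt Real.pi_pos.le
  have hv := (hpos n hn).ne'
  rw [Pi.div_apply]
  set v := (2 * √π)⁻¹ * A ^ (κ / 2 + 1 / 4) * (n : ℝ) ^ (-κ / 2 - 3 / 4) *
    Real.exp (2 * √(A * n))
  set u := √(√(A * n)) * ((A / √(A * n)) ^ (-κ) * Real.exp (-2 * √(A * n))) / (A / √(A * n))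
  have hu : u = (2 * √π)⁻¹ / v := by rw [eq_div_iff hv]; exact hid
  have hsqc : ((√π : ℝ) : ℂ) * (√π : ℝ) = π := by exact_mod_cast hsq
  have h2 : ((√π : ℝ) : ℂ) ≠ 0 := by exact_mod_cast hpi.ne'
  have hvc : (v : ℂ) ≠ 0 := by exact_mod_cast hv
  clear_value u v
  rw [hu, ← hsqc]
  push_cast
  field_simp

/-! ### Euler products and the substitution q ↦ -q -/

/-- The Euler product `∏_{m ≥ 1} (1 - q ^ m)`. -/
noncomputable def eulerProd (q : ℂ) : ℂ := ∏' n : ℕ, (1 - q ^ (n + 1))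

/-- The product of `1 - q ^ m` over the odd `m ≥ 1`. -/
noncomputable def oddEulerProd (q : ℂ) : ℂ := ∏' n : ℕ, (1 - q ^ (2 * n + 1))

theorem one_sub_pow_succ_ne_zero {q : ℂ} (hq : ‖q‖ < 1) (n : ℕ) : 1 - q ^ (n + 1) ≠ 0 := by
  intro h
  have h1 : ‖q ^ (n + 1)‖ < 1 := by
    rw [norm_pow]; exact pow_lt_one₀ (norm_nonneg _) hq (by omega)
  rw [← sub_eq_zero.1 h, norm_one] at h1
  exact lt_irrefl _ h1

theorem summable_norm_neg_pow_succ {q : ℂ} (hq : ‖q‖ < 1) :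
    Summable fun n : ℕ => ‖-q ^ (n + 1)‖ := by
  simpa using (summable_nat_add_iff 1).mpr (summable_geometric_of_lt_one (norm_nonneg _) hq)

theorem summable_norm_neg_pow_odd {q : ℂ} (hq : ‖q‖ < 1) :
    Summable fun n : ℕ => ‖-q ^ (2 * n + 1)‖ :=
  (summable_norm_neg_pow_succ hq).comp_injective (i := fun n => 2 * n)
    (fun a b h => by simpa using h)

theorem eulerProd_ne_zero {q : ℂ} (hq : ‖q‖ < 1) : eulerProd q ≠ 0 := by
  simp only [eulerProd, sub_eq_add_neg]
  exact tprod_one_add_ne_zero_of_summable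
    (fun n => by simpa [sub_eq_add_neg] using one_sub_pow_succ_ne_zero hq n)
    (summable_norm_neg_pow_succ hq)

theorem oddEulerProd_ne_zero {q : ℂ} (hq : ‖q‖ < 1) : oddEulerProd q ≠ 0 := by
  simp only [oddEulerProd, sub_eq_add_neg]
  exact tprod_one_add_ne_zero_of_summable
    (fun n => by simpa [sub_eq_add_neg] using one_sub_pow_succ_ne_zero hq (2 * n))
    (summable_norm_neg_pow_odd hq)

theorem multipliable_one_sub_pow_odd {q : ℂ} (hq : ‖q‖ < 1) :
    Multipliable fun n : ℕ => 1 - q ^ (2 * n + 1) := by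
  simp only [sub_eq_add_neg]
  exact multipliable_one_add_of_summable (summable_norm_neg_pow_odd hq)

theorem differentiableOn_eulerProd : DifferentiableOn ℂ eulerProd (Metric.ball 0 1) :=
  ModularForm.differentiableOn_tprod_one_sub_pow

theorem eulerProd_zero : eulerProd 0 = 1 := by simp [eulerProd]

theorem norm_sq_lt_one {q : ℂ} (hq : ‖q‖ < 1) : ‖q ^ 2‖ < 1 := by
  rw [norm_pow]; exact pow_lt_one₀ (norm_nonneg _) hq two_ne_zero

theorem eulerProd_eq_odd_mul {q : ℂ} (hq : ‖q‖ < 1) :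
    eulerProd q = oddEulerProd q * eulerProd (q ^ 2) := by
  have h1 : (fun n : ℕ => 1 - (q ^ 2) ^ (n + 1)) = fun n : ℕ => 1 - q ^ (2 * n + 1 + 1) := by
    ext n; rw [← pow_mul]; ring_nf
  have h2 := ModularForm.multipliable_one_sub_pow (norm_sq_lt_one hq)
  rw [h1] at h2
  rw [eulerProd, oddEulerProd, eulerProd, h1]
  exact (tprod_even_mul_odd (f := fun n : ℕ => 1 - q ^ (n + 1))
    (multipliable_one_sub_pow_odd hq) h2).symm

theorem oddEulerProd_mul_neg {q : ℂ} (hq : ‖q‖ < 1) :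
    oddEulerProd q * oddEulerProd (-q) = oddEulerProd (q ^ 2) := by
  rw [oddEulerProd, oddEulerProd, oddEulerProd, ← Multipliable.tprod_mul
    (multipliable_one_sub_pow_odd hq) (multipliable_one_sub_pow_odd (by simpa using hq))]
  refine tprod_congr fun n => ?_
  rw [Odd.neg_pow ⟨n, rfl⟩]
  ring

/-- From E(-q) = O(-q) E(q²), O(q) O(-q) = O(q²) and O(x) = E(x)/E(x²). It transfers the behaviour
at q = -1 to q = 1. -/
theorem eulerProd_neg {q : ℂ} (hq : ‖q‖ < 1) :
    eulerProd (-q) = eulerProd (q ^ 2) ^ 3 / (eulerProd q * eulerProd (q ^ 4)) := by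
  have hq2 := norm_sq_lt_one hq
  have h1 := eulerProd_eq_odd_mul hq
  have h2 := eulerProd_eq_odd_mul (q := -q) (by simpa using hq)
  have h3 := eulerProd_eq_odd_mul hq2
  have h4 := oddEulerProd_mul_neg hq
  have h5 : (q ^ 2) ^ 2 = q ^ 4 := by ring
  rw [neg_sq] at h2
  rw [h5] at h3
  have hne1 := eulerProd_ne_zero hq
  have hne4 : eulerProd (q ^ 4) ≠ 0 := by
    rw [← h5]; exact eulerProd_ne_zero (norm_sq_lt_one hq2)
  rw [eq_div_iff (mul_ne_zero hne1 hne4), h2, h1]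
  calc _ = (oddEulerProd q * oddEulerProd (-q)) * eulerProd (q ^ 4) * eulerProd (q ^ 2) ^ 2 := by
        ring
    _ = _ := by rw [h4, ← h3]; ring

theorem eta_eq_qParam_mul_eulerProd (z : ℂ) :
    η z = Function.Periodic.qParam 24 z * eulerProd (Function.Periodic.qParam 1 z) := rfl

/-! ### Modular inversion and the behaviour as q → 1 -/

/-- The transformation law of `∏ (1 - q ^ m)`, `q = exp (-w)`, under `w ↦ 4π² / w`. -/
theorem eulerProd_exp_neg {w : ℂ} (hw : 0 < w.re) :
    Complex.exp (-(π ^ 2 / (6 * w))) * eulerProd (Complex.exp (-(4 * π ^ 2 / w))) =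
      (w / (2 * π)) ^ (1 / 2 : ℂ) * (Complex.exp (-(w / 24)) * eulerProd (Complex.exp (-w))) := by
  have hw0 : w ≠ 0 := by rintro rfl; simp at hw
  have hpi : (π : ℂ) ≠ 0 := by exact_mod_cast Real.pi_ne_zero
  -- The modular variable is τ = iu, so that e^{2πiτ} = e^{-w} and -1/τ = 2πi/w.
  set u : ℂ := w / (2 * π) with hu
  have hu' : u = ((2 * π : ℝ)⁻¹ : ℝ) * w := by
    rw [hu]; push_cast; field_simp
  have hure : 0 < u.re := by rw [hu', Complex.re_ofReal_mul]; positivity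
  have hu0 : u ≠ 0 := by rintro h; simp [h] at hure
  have hz : Complex.I * u ∈ UpperHalfPlane.upperHalfPlaneSet := by
    simpa [UpperHalfPlane.upperHalfPlaneSet] using hure
  have h := ModularForm.eta_comp_eq_csqrt_I_inv hz
  -- No branch jump: |arg u| < π/2 and arg i = π/2, so the arguments add to a value in (-π, π].
  have hlog : Complex.log (Complex.I * u) = Complex.log Complex.I + Complex.log u := by
    refine Complex.log_mul Complex.I_ne_zero hu0 ?_
    have h1 : |u.arg| < π / 2 := Complex.abs_arg_lt_pi_div_two_iff.2 (Or.inl hure)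
    rw [abs_lt] at h1
    rw [Complex.arg_I]
    constructor <;> linarith [Real.pi_pos]
  have hsqrt : (Complex.sqrt Complex.I)⁻¹ * Complex.sqrt (Complex.I * u) = u ^ (1 / 2 : ℂ) := by
    rw [Complex.sqrt, Complex.sqrt, Complex.cpow_def_of_ne_zero Complex.I_ne_zero,
      Complex.cpow_def_of_ne_zero (mul_ne_zero Complex.I_ne_zero hu0), hlog,
      Complex.cpow_def_of_ne_zero hu0, ← Complex.exp_neg, ← Complex.exp_add]
    congr 1; ring
  simp only [Function.comp_apply, Pi.smul_apply, Pi.mul_apply, smul_eq_mul, ← mul_assoc] at h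
  rw [hsqrt, eta_eq_qParam_mul_eulerProd, eta_eq_qParam_mul_eulerProd] at h
  have hI : (-1 : ℂ) / (Complex.I * u) = Complex.I * (2 * π / w) := by
    rw [hu]; field_simp; simp
  have e1 : Function.Periodic.qParam 24 (-1 / (Complex.I * u)) =
      Complex.exp (-(π ^ 2 / (6 * w))) := by
    rw [hI, Function.Periodic.qParam]; congr 1; field_simp; push_cast; ring_nf; simp
  have e2 : Function.Periodic.qParam 1 (-1 / (Complex.I * u)) =
      Complex.exp (-(4 * π ^ 2 / w)) := by
    rw [hI, Function.Periodic.qParam]; congr 1; field_simp; push_cast; ring_nf; simp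
  have e3 : Function.Periodic.qParam 24 (Complex.I * u) = Complex.exp (-(w / 24)) := by
    rw [Function.Periodic.qParam, hu]; congr 1; field_simp; push_cast; ring_nf; simp
  have e4 : Function.Periodic.qParam 1 (Complex.I * u) = Complex.exp (-w) := by
    rw [Function.Periodic.qParam, hu]; congr 1; field_simp; push_cast; ring_nf; simp
  rw [e1, e2, e3, e4] at h
  exact h

/-- In the sector ‖w‖ ≤ 2 Re w, hence Re(1/w) = Re w/‖w‖² ≥ 1/(2‖w‖). For unrestricted w in the half
plane Re(1/w) could stay bounded. -/
theorem tendsto_exp_neg_div_stolzSector {b : ℝ} (hb : 0 < b) :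
    Tendsto (fun w : ℂ => Complex.exp (-(b / w))) (𝓝[stolzSector] 0) (𝓝 0) := by
  rw [tendsto_zero_iff_norm_tendsto_zero]
  have h1 : Tendsto (fun w : ℂ => ‖w‖) (𝓝[stolzSector] 0) (𝓝[>] 0) := by
    refine tendsto_nhdsWithin_iff.2 ⟨?_, ?_⟩
    · exact (continuous_norm.tendsto' 0 0 norm_zero).mono_left nhdsWithin_le_nhds
    · filter_upwards [self_mem_nhdsWithin] with w hw
      refine norm_pos_iff.2 ?_
      rintro rfl
      simpa using hw.1
  have h2 : Tendsto (fun w : ℂ => Real.exp (-(b / 2 * ‖w‖⁻¹))) (𝓝[stolzSector] 0) (𝓝 0) :=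
    Real.tendsto_exp_neg_atTop_nhds_zero.comp
      ((tendsto_inv_nhdsGT_zero.comp h1).const_mul_atTop (by positivity))
  refine squeeze_zero' (.of_forall fun _ => norm_nonneg _) ?_ h2
  filter_upwards [self_mem_nhdsWithin] with w hw
  have hw0 : 0 < ‖w‖ := by
    refine norm_pos_iff.2 ?_
    rintro rfl
    simpa using hw.1
  rw [Complex.norm_exp, Real.exp_le_exp, Complex.neg_re, neg_le_neg_iff, Complex.div_re,
    Complex.ofReal_re, Complex.ofReal_im, Complex.normSq_eq_norm_sq]
  have h3 : ‖w‖ ≤ 2 * w.re := by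
    linarith [Complex.norm_le_abs_re_add_abs_im w, hw.2, abs_of_pos hw.1]
  rw [zero_mul, zero_div, add_zero, div_mul_eq_mul_div, ← div_eq_mul_inv, div_div,
    div_le_div_iff₀ (by positivity) (by positivity)]
  nlinarith [mul_pos hb hw0]

/-- Inversion replaces the nome e^{-w} → 1 by e^{-4π²/w} → 0, where E tends to E(0) = 1; only the
explicit factors remain. -/
theorem tendsto_eulerProd_exp_neg :
    Tendsto (fun w : ℂ => eulerProd (Complex.exp (-w)) *
      (w ^ (1 / 2 : ℂ) * Complex.exp (π ^ 2 / 6 / w)))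
      (𝓝[stolzSector] 0) (𝓝 (√(2 * π) : ℝ)) := by
  have h0 : Tendsto eulerProd (𝓝 0) (𝓝 1) := by
    have := (differentiableOn_eulerProd.differentiableAt
      (Metric.ball_mem_nhds 0 one_pos)).continuousAt.tendsto
    rwa [eulerProd_zero] at this
  have h1 := h0.comp (tendsto_exp_neg_div_stolzSector (b := 4 * π ^ 2) (by positivity))
  have h2 : Tendsto (fun w : ℂ => Complex.exp (w / 24)) (𝓝[stolzSector] 0) (𝓝 1) := by
    have : Continuous fun w : ℂ => Complex.exp (w / 24) := by fun_prop
    exact (this.tendsto' 0 1 (by simp)).mono_left nhdsWithin_le_nhds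
  have h3 := (h2.mul h1).const_mul ((√(2 * π) : ℝ) : ℂ)
  rw [mul_one, mul_one] at h3
  refine h3.congr' ?_
  filter_upwards [self_mem_nhdsWithin] with w hw
  have hw0 : w ≠ 0 := by rintro rfl; simpa using hw.1
  have h := eulerProd_exp_neg hw.1
  have hcp : w ^ (1 / 2 : ℂ) = ((√(2 * π) : ℝ) : ℂ) * (w / (2 * π)) ^ (1 / 2 : ℂ) := by
    have hpos : 0 < 2 * π := by positivity
    have h6 : w = ((2 * π : ℝ) : ℂ) * (w / (2 * π)) := by
      have hpi : (π : ℂ) ≠ 0 := by exact_mod_cast Real.pi_ne_zero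
      push_cast; field_simp
    have h7 : w / (2 * π) ≠ 0 := by
      intro h; rw [h, mul_zero] at h6; exact hw0 h6
    conv_lhs => rw [h6]
    rw [Complex.cpow_def_of_ne_zero (mul_ne_zero (by exact_mod_cast hpos.ne') h7),
      Complex.log_ofReal_mul hpos h7, Complex.cpow_def_of_ne_zero h7, add_mul, Complex.exp_add]
    congr 1
    rw [Real.sqrt_eq_rpow, Real.rpow_def_of_pos hpos]
    push_cast
    rfl
  have e1 : Complex.exp (w / 24) * Complex.exp (-(w / 24)) = 1 := by
    rw [← Complex.exp_add]; simp
  have e2 : Complex.exp (π ^ 2 / 6 / w) * Complex.exp (-(π ^ 2 / (6 * w))) = 1 := by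
    rw [← Complex.exp_add, Complex.exp_eq_one_iff]; exact ⟨0, by field_simp; simp⟩
  have h8 : eulerProd (Complex.exp (-(((4 * π ^ 2 : ℝ) : ℂ) / w))) =
      eulerProd (Complex.exp (-(4 * π ^ 2 / w))) := by push_cast; rfl
  simp only [Function.comp_apply]
  rw [h8, hcp]
  calc _ = ((√(2 * π) : ℝ) : ℂ) * Complex.exp (w / 24) * Complex.exp (π ^ 2 / 6 / w) *
        (Complex.exp (-(π ^ 2 / (6 * w))) * eulerProd (Complex.exp (-(4 * π ^ 2 / w)))) := by
        linear_combination (-((√(2 * π) : ℝ) : ℂ) * Complex.exp (w / 24) *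
          eulerProd (Complex.exp (-(4 * π ^ 2 / w)))) * e2
    _ = _ := by
        rw [h]
        linear_combination (((√(2 * π) : ℝ) : ℂ) * (w / (2 * π)) ^ (1 / 2 : ℂ) *
          eulerProd (Complex.exp (-w)) * Complex.exp (π ^ 2 / 6 / w)) * e1

theorem tendsto_eulerProd_exp_neg_mul {j : ℝ} (hj : 0 < j) :
    Tendsto (fun w : ℂ => eulerProd (Complex.exp (-(j * w))) *
      (w ^ (1 / 2 : ℂ) * Complex.exp (π ^ 2 / 6 / j / w)))
      (𝓝[stolzSector] 0) (𝓝 (√(2 * π / j) : ℝ)) := by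
  have hjw : Tendsto (fun w : ℂ => (j : ℂ) * w) (𝓝[stolzSector] 0) (𝓝[stolzSector] 0) := by
    refine tendsto_nhdsWithin_iff.2 ⟨?_, ?_⟩
    · have : Continuous fun w : ℂ => (j : ℂ) * w := by fun_prop
      exact (this.tendsto' 0 0 (by simp)).mono_left nhdsWithin_le_nhds
    · filter_upwards [self_mem_nhdsWithin] with w hw
      refine ⟨?_, ?_⟩
      · rw [Complex.re_ofReal_mul]; exact mul_pos hj hw.1
      · rw [Complex.re_ofReal_mul, Complex.im_ofReal_mul, abs_mul, abs_of_pos hj]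
        exact mul_le_mul_of_nonneg_left hw.2 hj.le
  have h := (tendsto_eulerProd_exp_neg.comp hjw).div_const ((√j : ℝ) : ℂ)
  have hsj : ((√j : ℝ) : ℂ) ≠ 0 := by exact_mod_cast (Real.sqrt_pos.2 hj).ne'
  rw [Real.sqrt_div (by positivity), Complex.ofReal_div]
  refine h.congr' ?_
  filter_upwards [self_mem_nhdsWithin] with w hw
  have hw0 : w ≠ 0 := by rintro rfl; simpa using hw.1
  have hj0 : (j : ℂ) ≠ 0 := by exact_mod_cast hj.ne'
  have hcp : ((j : ℂ) * w) ^ (1 / 2 : ℂ) = ((√j : ℝ) : ℂ) * w ^ (1 / 2 : ℂ) := by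
    rw [Complex.cpow_def_of_ne_zero (mul_ne_zero hj0 hw0), Complex.log_ofReal_mul hj hw0,
      Complex.cpow_def_of_ne_zero hw0, add_mul, Complex.exp_add]
    congr 1
    rw [Real.sqrt_eq_rpow, Real.rpow_def_of_pos hj]
    push_cast
    rfl
  simp only [Function.comp_apply]
  rw [hcp, div_div _ (j : ℂ) w]
  field_simp

/-- Behaviour of `E(q)^a E(q²)^b E(q⁴)^c` as `q → 1` in a Stolz angle. -/
theorem tendsto_eulerProd_quotient (a b c : ℤ) :
    Tendsto (fun w : ℂ => (eulerProd (Complex.exp (-w)) ^ a * eulerProd (Complex.exp (-w) ^ 2) ^ b *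
        eulerProd (Complex.exp (-w) ^ 4) ^ c) /
      (w ^ (((-(a + b + c) / 2 : ℝ)) : ℂ) *
        Complex.exp ((-(π ^ 2 * (4 * a + 2 * b + c) / 24) : ℝ) / w))) (𝓝[stolzSector] 0)
      (𝓝 ((√(2 * π) ^ a * √π ^ b * √(π / 2) ^ c : ℝ) : ℂ)) := by
  have h1 := tendsto_eulerProd_exp_neg_mul one_pos
  have h2 := tendsto_eulerProd_exp_neg_mul two_pos
  have h4 := tendsto_eulerProd_exp_neg_mul four_pos
  have hne : ∀ {x : ℝ}, 0 < x → ((√x : ℝ) : ℂ) ≠ 0 := fun hx => by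
    exact_mod_cast (Real.sqrt_pos.2 hx).ne'
  have h := ((h1.zpow₀ a (Or.inl (hne (by positivity)))).mul
    (h2.zpow₀ b (Or.inl (hne (by positivity))))).mul (h4.zpow₀ c (Or.inl (hne (by positivity))))
  have hlim : (((√(2 * π / 1) : ℝ) : ℂ) ^ a * ((√(2 * π / 2) : ℝ) : ℂ) ^ b *
      ((√(2 * π / 4) : ℝ) : ℂ) ^ c) = ((√(2 * π) ^ a * √π ^ b * √(π / 2) ^ c : ℝ) : ℂ) := by
    rw [show 2 * π / 1 = 2 * π by ring, show 2 * π / 2 = π by ring,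
      show 2 * π / 4 = π / 2 by ring]
    push_cast
    rfl
  rw [hlim] at h
  refine h.congr' ?_
  filter_upwards [self_mem_nhdsWithin] with w hw
  have hw0 : w ≠ 0 := by rintro rfl; simpa using hw.1
  have e1 : Complex.exp (-(((1 : ℝ) : ℂ) * w)) = Complex.exp (-w) := by simp
  have e2 : Complex.exp (-(((2 : ℝ) : ℂ) * w)) = Complex.exp (-w) ^ 2 := by
    rw [← Complex.exp_nat_mul]; congr 1; push_cast; ring
  have e4 : Complex.exp (-(((4 : ℝ) : ℂ) * w)) = Complex.exp (-w) ^ 4 := by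
    rw [← Complex.exp_nat_mul]; congr 1; push_cast; ring
  rw [e1, e2, e4]
  have hcp : (w ^ (((-(a + b + c) / 2 : ℝ)) : ℂ))⁻¹ = (w ^ (1 / 2 : ℂ)) ^ (a + b + c) := by
    rw [← Complex.cpow_mul_int, ← Complex.cpow_neg]
    congr 1; push_cast; ring
  have hs : w ^ (1 / 2 : ℂ) ≠ 0 := by
    rw [Complex.cpow_def_of_ne_zero hw0]; exact Complex.exp_ne_zero _
  have hexp : (Complex.exp ((-(π ^ 2 * (4 * a + 2 * b + c) / 24) : ℝ) / w))⁻¹ =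
      Complex.exp (π ^ 2 / 6 / (1 : ℝ) / w) ^ a * Complex.exp (π ^ 2 / 6 / (2 : ℝ) / w) ^ b *
      Complex.exp (π ^ 2 / 6 / (4 : ℝ) / w) ^ c := by
    rw [← Complex.exp_int_mul, ← Complex.exp_int_mul, ← Complex.exp_int_mul, ← Complex.exp_neg,
      ← Complex.exp_add, ← Complex.exp_add]
    congr 1; push_cast; field_simp; ring
  rw [div_eq_mul_inv _ (w ^ (((-(a + b + c) / 2 : ℝ)) : ℂ) * _), mul_inv, hcp, hexp,
    zpow_add₀ hs, zpow_add₀ hs]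
  simp only [mul_zpow]
  ring

/-! ### Minor arcs: the saving from odd factors -/

theorem norm_one_add_sq (z : ℂ) : ‖1 + z‖ ^ 2 = (1 + ‖z‖) ^ 2 - 2 * (‖z‖ - z.re) := by
  have h1 := Complex.sq_norm z
  rw [Complex.normSq_apply] at h1
  rw [Complex.sq_norm, Complex.normSq_apply]
  simp
  linarith

/-- With x = |z| - Re z, |1 + z|² = (1 + |z|)² - 2x and (1 + |z|)² ≤ 4 bound the squared ratio by 1
- x/2 ≤ e^{-x/2}; the square root turns 2 into 4. -/
theorem norm_one_add_le_mul_exp {z : ℂ} (hz : ‖z‖ < 1) :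
    ‖1 + z‖ ≤ (1 + ‖z‖) * Real.exp (-((‖z‖ - z.re) / 4)) := by
  refine le_of_sq_le_sq ?_ (by positivity)
  have hx : 0 ≤ ‖z‖ - z.re := sub_nonneg.2 (Complex.re_le_norm z)
  have hr := norm_nonneg z
  have he : Real.exp (-((‖z‖ - z.re) / 4)) ^ 2 = Real.exp (-((‖z‖ - z.re) / 2)) := by
    rw [← Real.exp_nat_mul]; congr 1; push_cast; ring
  have h1 := Real.add_one_le_exp (-((‖z‖ - z.re) / 2))
  rw [norm_one_add_sq, mul_pow, he]
  have h2 : (1 + ‖z‖) ^ 2 ≤ 4 := by nlinarith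
  nlinarith [mul_le_mul_of_nonneg_left h1 (sq_nonneg (1 + ‖z‖)), mul_le_mul_of_nonneg_right h2 hx]

/-- The same argument from (1 - |z|)² = |1 - z|² - 2x and |1 - z|² ≤ 4. -/
theorem one_sub_norm_le_mul_exp {z : ℂ} (hz : ‖z‖ < 1) :
    1 - ‖z‖ ≤ ‖1 - z‖ * Real.exp (-((‖z‖ - z.re) / 4)) := by
  refine le_of_sq_le_sq ?_ (by positivity)
  have hx : 0 ≤ ‖z‖ - z.re := sub_nonneg.2 (Complex.re_le_norm z)
  have hr := norm_nonneg z
  have he : Real.exp (-((‖z‖ - z.re) / 4)) ^ 2 = Real.exp (-((‖z‖ - z.re) / 2)) := by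
    rw [← Real.exp_nat_mul]; congr 1; push_cast; ring
  have h1 := Real.add_one_le_exp (-((‖z‖ - z.re) / 2))
  have h3 : ‖1 - z‖ ^ 2 = (1 - ‖z‖) ^ 2 + 2 * (‖z‖ - z.re) := by
    have := norm_one_add_sq (-z)
    rw [← sub_eq_add_neg, norm_neg, Complex.neg_re] at this
    rw [this]; ring
  have h2 : ‖1 - z‖ ^ 2 ≤ 4 := by
    have : ‖1 - z‖ ≤ 2 := (norm_sub_le _ _).trans (by rw [norm_one]; linarith)
    nlinarith [norm_nonneg (1 - z)]
  rw [mul_pow, he]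
  nlinarith [mul_le_mul_of_nonneg_left h1 (sq_nonneg ‖1 - z‖), mul_le_mul_of_nonneg_right h2 hx]

/-- The loss on the odd factors: `∑ (|q| ^ m - Re q ^ m)` over the odd `m`, in closed form. -/
noncomputable def oddDefect (q : ℂ) : ℝ := ‖q‖ / (1 - ‖q‖ ^ 2) - (q / (1 - q ^ 2)).re

theorem hasSum_pow_odd {𝕜 : Type*} [NormedField 𝕜] {z : 𝕜} (hz : ‖z‖ < 1) :
    HasSum (fun n : ℕ => z ^ (2 * n + 1)) (z / (1 - z ^ 2)) := by
  have h2 : ‖z ^ 2‖ < 1 := by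
    rw [norm_pow]; exact pow_lt_one₀ (norm_nonneg _) hz two_ne_zero
  have h := (hasSum_geometric_of_norm_lt_one h2).mul_left z
  rw [← div_eq_mul_inv] at h
  exact h.congr_fun fun n => by rw [← pow_mul]; ring

theorem hasSum_oddDefect {q : ℂ} (hq : ‖q‖ < 1) :
    HasSum (fun n : ℕ => ‖q ^ (2 * n + 1)‖ - (q ^ (2 * n + 1)).re) (oddDefect q) := by
  have hr : ‖‖q‖‖ < 1 := by simpa using hq
  have h1 := hasSum_pow_odd hr
  have h2 := Complex.hasSum_re (hasSum_pow_odd hq)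
  simp only [norm_pow, oddDefect]
  exact h1.sub h2

theorem tendsto_exp_neg_sum_oddDefect {q : ℂ} (hq : ‖q‖ < 1) :
    Tendsto (fun N : ℕ => ∏ n ∈ Finset.range N,
      Real.exp (-((‖q ^ (2 * n + 1)‖ - (q ^ (2 * n + 1)).re) / 4))) atTop
      (𝓝 (Real.exp (-(oddDefect q / 4)))) := by
  simp_rw [← Real.exp_sum]
  exact (Real.continuous_exp.tendsto _).comp
    ((hasSum_oddDefect hq).div_const 4).neg.tendsto_sum_nat

theorem norm_pow_odd_lt_one {q : ℂ} (hq : ‖q‖ < 1) (n : ℕ) : ‖q ^ (2 * n + 1)‖ < 1 := by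
  rw [norm_pow]; exact pow_lt_one₀ (norm_nonneg _) hq (by omega)

/-- The factorwise inequality is multiplied over odd m; the exponents add up to `oddDefect q / 4`.
-/
theorem norm_oddEulerProd_norm_le {q : ℂ} (hq : ‖q‖ < 1) :
    ‖oddEulerProd (‖q‖ : ℂ)‖ ≤ ‖oddEulerProd q‖ * Real.exp (-(oddDefect q / 4)) := by
  have hr : ‖((‖q‖ : ℝ) : ℂ)‖ < 1 := by simpa using hq
  refine le_of_tendsto_of_tendsto'
    (multipliable_one_sub_pow_odd hr).hasProd.tendsto_prod_nat.norm
    ((multipliable_one_sub_pow_odd hq).hasProd.tendsto_prod_nat.norm.mul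
      (tendsto_exp_neg_sum_oddDefect hq)) fun N => ?_
  rw [norm_prod, norm_prod, ← Finset.prod_mul_distrib]
  refine Finset.prod_le_prod (fun _ _ => norm_nonneg _) fun n _ => ?_
  have h := norm_pow_odd_lt_one hq n
  have h1 : ‖1 - ((‖q‖ : ℝ) : ℂ) ^ (2 * n + 1)‖ = 1 - ‖q ^ (2 * n + 1)‖ := by
    rw [← Complex.ofReal_pow, ← norm_pow, ← Complex.ofReal_one, ← Complex.ofReal_sub,
      Complex.norm_real, Real.norm_of_nonneg (by linarith)]
  rw [h1]
  exact one_sub_norm_le_mul_exp h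

theorem norm_oddEulerProd_neg_le {q : ℂ} (hq : ‖q‖ < 1) :
    ‖oddEulerProd (-q)‖ ≤ ‖oddEulerProd (-(‖q‖ : ℂ))‖ * Real.exp (-(oddDefect q / 4)) := by
  have hr : ‖(-(‖q‖ : ℝ) : ℂ)‖ < 1 := by simpa using hq
  refine le_of_tendsto_of_tendsto'
    (multipliable_one_sub_pow_odd (q := -q) (by simpa using hq)).hasProd.tendsto_prod_nat.norm
    ((multipliable_one_sub_pow_odd hr).hasProd.tendsto_prod_nat.norm.mul
      (tendsto_exp_neg_sum_oddDefect hq)) fun N => ?_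
  rw [norm_prod, norm_prod, ← Finset.prod_mul_distrib]
  refine Finset.prod_le_prod (fun _ _ => norm_nonneg _) fun n _ => ?_
  have h := norm_pow_odd_lt_one hq n
  have h1 : ‖1 - (-((‖q‖ : ℝ) : ℂ)) ^ (2 * n + 1)‖ = 1 + ‖q ^ (2 * n + 1)‖ := by
    rw [Odd.neg_pow ⟨n, rfl⟩, sub_neg_eq_add, ← Complex.ofReal_pow, ← norm_pow,
      ← Complex.ofReal_one, ← Complex.ofReal_add, Complex.norm_real,
      Real.norm_of_nonneg (by positivity)]
  rw [h1, Odd.neg_pow ⟨n, rfl⟩, sub_neg_eq_add]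
  exact norm_one_add_le_mul_exp h

theorem norm_eulerProd_norm_le {q : ℂ} (hq : ‖q‖ < 1) : ‖eulerProd (‖q‖ : ℂ)‖ ≤ ‖eulerProd q‖ := by
  have hr : ‖((‖q‖ : ℝ) : ℂ)‖ < 1 := by simpa using hq
  refine le_of_tendsto_of_tendsto'
    (ModularForm.multipliable_one_sub_pow hr).hasProd.tendsto_prod_nat.norm
    (ModularForm.multipliable_one_sub_pow hq).hasProd.tendsto_prod_nat.norm fun N => ?_
  rw [norm_prod, norm_prod]
  refine Finset.prod_le_prod (fun _ _ => norm_nonneg _) fun n _ => ?_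
  have h : ‖q ^ (n + 1)‖ < 1 := by
    rw [norm_pow]; exact pow_lt_one₀ (norm_nonneg _) hq (by omega)
  have h1 : ‖1 - ((‖q‖ : ℝ) : ℂ) ^ (n + 1)‖ = 1 - ‖q ^ (n + 1)‖ := by
    rw [← Complex.ofReal_pow, ← norm_pow, ← Complex.ofReal_one, ← Complex.ofReal_sub,
      Complex.norm_real, Real.norm_of_nonneg (by linarith)]
  rw [h1, ← norm_one (α := ℂ)]
  exact norm_sub_norm_le _ _

theorem oddDefect_eq (q : ℂ) : oddDefect q = ‖q‖ / (1 - ‖q‖ ^ 2) -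
    q.re * (1 - ‖q‖ ^ 2) / ((1 - ‖q‖ ^ 2) ^ 2 + 4 * q.im ^ 2) := by
  have h1 := Complex.sq_norm q
  rw [Complex.normSq_apply] at h1
  have hre : (1 - q ^ 2).re = 1 - q.re ^ 2 + q.im ^ 2 := by simp [pow_two]; ring
  have him : (1 - q ^ 2).im = -(2 * q.re * q.im) := by simp [pow_two]; ring
  have hn : Complex.normSq (1 - q ^ 2) = (1 - ‖q‖ ^ 2) ^ 2 + 4 * q.im ^ 2 := by
    rw [Complex.normSq_apply, hre, him, h1]; ring
  rw [oddDefect, Complex.div_re, hn, hre, him, h1]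
  ring

/-- Away from the point `1` the defect is at least a constant multiple of `1 / t`. -/
theorem le_oddDefect {t θ : ℝ} (ht : 0 < t) (ht2 : t ≤ 1 / 2) (hθ : t ≤ |θ|) (hθπ : |θ| ≤ π) :
    1 / (4 * (π ^ 2 + 1)) / t ≤ oddDefect (Complex.exp (-t + θ * Complex.I)) := by
  have hnorm : ‖Complex.exp (-t + θ * Complex.I)‖ = Real.exp (-t) := by simp [Complex.norm_exp]
  have hre : (Complex.exp (-t + θ * Complex.I)).re = Real.exp (-t) * Real.cos θ := by
    simp [Complex.exp_re]
  have him : (Complex.exp (-t + θ * Complex.I)).im = Real.exp (-t) * Real.sin θ := by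
    simp [Complex.exp_im]
  rw [oddDefect_eq, hnorm, hre, him]
  set r := Real.exp (-t) with hr
  have hr0 : 0 < r := Real.exp_pos _
  have hr1 : r < 1 := by rw [hr]; simpa using ht
  have hrhalf : 1 / 2 ≤ r := by linarith [Real.add_one_le_exp (-t)]
  have hu0 : 0 < 1 - r ^ 2 := by nlinarith
  have hu : 1 - r ^ 2 ≤ 2 * t := by
    have h1 := Real.add_one_le_exp (-(2 * t))
    have h2 : r ^ 2 = Real.exp (-(2 * t)) := by
      rw [hr, ← Real.exp_nat_mul]; congr 1; push_cast; ring
    linarith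
  set u := 1 - r ^ 2
  have hπ := Real.pi_pos
  -- From r ≥ 1/2 and u ≤ 2t.
  have hru : 1 / (4 * t) ≤ r / u := by
    rw [div_le_div_iff₀ (by positivity) hu0]
    nlinarith
  -- For |θ| ≤ π/2, Jordan's inequality gives u² ≤ π²Y with Y = 4(Im q)², so at least the fraction
  -- 1/(π² + 1) of r/u survives. Otherwise cos θ ≤ 0 and the subtracted term only helps.
  rcases le_or_gt |θ| (π / 2) with h | h
  · have hsin := Real.mul_abs_le_abs_sin h
    have hs2 : u ^ 2 ≤ π ^ 2 * (4 * (r * Real.sin θ) ^ 2) := by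
      have h1 : 2 * t ≤ π * |Real.sin θ| := by
        calc 2 * t ≤ 2 * |θ| := by linarith
          _ = π * (2 / π * |θ|) := by field_simp
          _ ≤ _ := by gcongr
      have h2 : u ≤ π * (2 * r * |Real.sin θ|) := by
        calc u ≤ π * |Real.sin θ| := hu.trans h1
          _ ≤ _ := by
            gcongr
            nlinarith [abs_nonneg (Real.sin θ)]
      calc u ^ 2 ≤ (π * (2 * r * |Real.sin θ|)) ^ 2 := by gcongr
        _ = π ^ 2 * (4 * r ^ 2 * |Real.sin θ| ^ 2) := by ring
        _ = _ := by rw [sq_abs]; ring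
    set Y := 4 * (r * Real.sin θ) ^ 2 with hY
    have hY0 : 0 ≤ Y := by positivity
    have hcos : r * Real.cos θ * u / (u ^ 2 + Y) ≤ r * u / (u ^ 2 + Y) := by
      gcongr
      nlinarith [Real.cos_le_one θ]
    have h3 : r / u - r * u / (u ^ 2 + Y) = r / u * (Y / (u ^ 2 + Y)) := by
      field_simp
      ring
    have h4 : 1 / (π ^ 2 + 1) ≤ Y / (u ^ 2 + Y) := by
      rw [div_le_div_iff₀ (by positivity) (by positivity)]
      linarith
    calc _ = 1 / (4 * t) * (1 / (π ^ 2 + 1)) := by field_simp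
      _ ≤ r / u * (Y / (u ^ 2 + Y)) := by gcongr
      _ ≤ _ := by rw [← h3]; linarith
  · have hcos : Real.cos θ ≤ 0 := by
      rw [← Real.cos_abs]
      exact Real.cos_nonpos_of_pi_div_two_le_of_le h.le (by linarith)
    have h1 : r * Real.cos θ * u / (u ^ 2 + 4 * (r * Real.sin θ) ^ 2) ≤ 0 := by
      refine div_nonpos_of_nonpos_of_nonneg ?_ (by positivity)
      exact mul_nonpos_of_nonpos_of_nonneg (mul_nonpos_of_nonneg_of_nonpos hr0.le hcos) hu0.le
    calc 1 / (4 * (π ^ 2 + 1)) / t ≤ 1 / (4 * t) := by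
          rw [div_div]
          gcongr
          nlinarith [sq_nonneg π]
      _ ≤ _ := by linarith

theorem zpow_le_zpow_of_nonpos {a b : ℝ} (ha : 0 < a) (hab : a ≤ b) {n : ℤ} (hn : n ≤ 0) :
    b ^ n ≤ a ^ n := by
  obtain ⟨m, rfl⟩ : ∃ m : ℕ, n = -m := ⟨n.natAbs, by omega⟩
  simp only [zpow_neg, zpow_natCast]
  gcongr

/-! ### The eta quotient as a function on the disc -/

/-- The product `∏ (1 - q ^ m) ^ α (1 - q ^ (2 m)) ^ β` as a function on the unit disc. -/
noncomputable def etaQuotientDisc (α β : ℤ) (q : ℂ) : ℂ := eulerProd q ^ α * eulerProd (q ^ 2) ^ β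

theorem etaQuotientDisc_eq_odd {q : ℂ} (hq : ‖q‖ < 1) (α β : ℤ) :
    etaQuotientDisc α β q = oddEulerProd q ^ α * eulerProd (q ^ 2) ^ (α + β) := by
  rw [etaQuotientDisc, eulerProd_eq_odd_mul hq, mul_zpow,
    zpow_add₀ (eulerProd_ne_zero (norm_sq_lt_one hq))]
  ring

theorem norm_eulerProd_sq_zpow_le {q : ℂ} (hq : ‖q‖ < 1) {s : ℤ} (hs : s ≤ 0) :
    ‖eulerProd (q ^ 2)‖ ^ s ≤ ‖eulerProd ((‖q‖ : ℂ) ^ 2)‖ ^ s := by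
  have h := norm_eulerProd_norm_le (norm_sq_lt_one hq)
  rw [norm_pow, Complex.ofReal_pow] at h
  have hr : ‖((‖q‖ : ℝ) : ℂ)‖ < 1 := by simpa using hq
  exact zpow_le_zpow_of_nonpos (norm_pos_iff.2 (eulerProd_ne_zero (norm_sq_lt_one hr))) h hs

theorem exp_zpow (x : ℝ) (n : ℤ) : Real.exp x ^ n = Real.exp (n * x) := by
  rw [← Real.rpow_intCast, ← Real.exp_mul, mul_comm]

/-- Both exponents in the odd/even splitting are nonpositive, so the lower bounds for |O(q)| and
|E(q²)| become upper bounds. -/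
theorem norm_etaQuotientDisc_le {q : ℂ} (hq : ‖q‖ < 1) {α β : ℤ} (hα : α ≤ 0) (hαβ : α + β ≤ 0) :
    ‖etaQuotientDisc α β q‖ ≤
      ‖etaQuotientDisc α β (‖q‖ : ℂ)‖ * Real.exp (α * (oddDefect q / 4)) := by
  have hr : ‖((‖q‖ : ℝ) : ℂ)‖ < 1 := by simpa using hq
  rw [etaQuotientDisc_eq_odd hq, etaQuotientDisc_eq_odd hr, norm_mul, norm_mul, norm_zpow,
    norm_zpow, norm_zpow, norm_zpow, mul_right_comm]
  refine mul_le_mul ?_ (norm_eulerProd_sq_zpow_le hq hαβ) (by positivity) (by positivity)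
  have h := zpow_le_zpow_of_nonpos (norm_pos_iff.2 (oddEulerProd_ne_zero hr))
    (norm_oddEulerProd_norm_le hq) hα
  rw [mul_zpow, exp_zpow] at h
  calc _ = ‖oddEulerProd q‖ ^ α * Real.exp (α * -(oddDefect q / 4)) *
        Real.exp (α * (oddDefect q / 4)) := by
        rw [mul_assoc, ← Real.exp_add]; simp
    _ ≤ _ := by gcongr

/-- E(q²) is unchanged by q ↦ -q, and the exponent α ≥ 0 preserves the upper bound for |O(-q)|. -/
theorem norm_etaQuotientDisc_neg_le {q : ℂ} (hq : ‖q‖ < 1) {α β : ℤ} (hα : 0 ≤ α)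
    (hαβ : α + β ≤ 0) :
    ‖etaQuotientDisc α β (-q)‖ ≤
      ‖etaQuotientDisc α β (-(‖q‖ : ℂ))‖ * Real.exp (-α * (oddDefect q / 4)) := by
  have hr : ‖(-(‖q‖ : ℝ) : ℂ)‖ < 1 := by simpa using hq
  rw [etaQuotientDisc_eq_odd (q := -q) (by simpa using hq), etaQuotientDisc_eq_odd hr, norm_mul,
    norm_mul, norm_zpow, norm_zpow, norm_zpow, norm_zpow, mul_right_comm, neg_sq, neg_sq]
  refine mul_le_mul ?_ (norm_eulerProd_sq_zpow_le hq hαβ) (by positivity) (by positivity)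
  have h := zpow_le_zpow_left₀ hα (norm_nonneg _) (norm_oddEulerProd_neg_le hq)
  rw [mul_zpow, exp_zpow] at h
  refine h.trans_eq ?_
  congr 2
  ring

/-- A saving of `exp (-k * oddDefect)` gives the minor arc hypothesis of
`taylorCoeff_isEquivalent`. -/
theorem exists_minorArc_bound {F : ℂ → ℂ} {k : ℝ} (hk : 0 < k)
    (hF : ∀ q : ℂ, ‖q‖ < 1 → ‖F q‖ ≤ ‖F (‖q‖ : ℂ)‖ * Real.exp (-k * oddDefect q)) :
    ∃ c > 0, ∀ᶠ t : ℝ in 𝓝[>] 0, ∀ θ : ℝ, t ≤ |θ| → |θ| ≤ π →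
      ‖F (Complex.exp (-t + θ * Complex.I))‖ ≤ ‖F (Complex.exp (-t))‖ * Real.exp (-c / t) := by
  refine ⟨k * (1 / (4 * (π ^ 2 + 1))), by positivity, ?_⟩
  filter_upwards [Ioc_mem_nhdsGT (show (0 : ℝ) < 1 / 2 by norm_num)] with t ht θ hθ hθπ
  have hnorm : ‖Complex.exp (-t + θ * Complex.I)‖ = Real.exp (-t) := by simp [Complex.norm_exp]
  refine (hF _ (by rw [hnorm]; simpa using ht.1)).trans ?_
  rw [hnorm]
  push_cast
  gcongr
  have h := le_oddDefect ht.1 ht.2 hθ hθπ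
  rw [neg_mul, neg_div, neg_le_neg_iff, mul_div_assoc]
  gcongr

theorem differentiableOn_etaQuotientDisc (α β : ℤ) :
    DifferentiableOn ℂ (etaQuotientDisc α β) (Metric.ball 0 1) := by
  have h2 : DifferentiableOn ℂ (fun q : ℂ => eulerProd (q ^ 2)) (Metric.ball 0 1) :=
    differentiableOn_eulerProd.comp (by fun_prop) fun q hq => by
      simpa using norm_sq_lt_one (by simpa using hq)
  refine (differentiableOn_eulerProd.zpow (Or.inl fun q hq => ?_)).mul
    (h2.zpow (Or.inl fun q hq => ?_))
  · exact eulerProd_ne_zero (by simpa using hq)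
  · exact eulerProd_ne_zero (norm_sq_lt_one (by simpa using hq))

theorem taylorCoeff_comp_neg (F : ℂ → ℂ) (n : ℕ) :
    taylorCoeff (fun q => F (-q)) n = (-1) ^ n * taylorCoeff F n := by
  rw [taylorCoeff, taylorCoeff, iteratedDeriv_comp_neg, neg_zero, smul_eq_mul]
  ring

/-- Squaring maps the circle of radius e^{-1} twice onto that of radius e^{-2}. In Cauchy's formula
the two periods cancel the factor 1/2 from θ ↦ 2θ. -/
theorem taylorCoeff_comp_sq {F : ℂ → ℂ} (hF : DifferentiableOn ℂ F (Metric.ball 0 1)) (n : ℕ) :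
    taylorCoeff (fun q => F (q ^ 2)) (2 * n) = taylorCoeff F n := by
  have hG : DifferentiableOn ℂ (fun q : ℂ => F (q ^ 2)) (Metric.ball 0 1) :=
    hF.comp (by fun_prop) fun q hq => by simpa using norm_sq_lt_one (by simpa using hq)
  set g : ℝ → ℂ := fun θ => F (Complex.exp (-((2 : ℝ) : ℝ) + θ * Complex.I)) *
    Complex.exp (n * ((2 : ℝ) - θ * Complex.I)) with hg
  have hper : Function.Periodic g (2 * π) := periodic_circle_integrand F n 2
  have hcont : Continuous g := by
    have h1 : Continuous fun θ : ℝ => F (Complex.exp (-((2 : ℝ) : ℝ) + θ * Complex.I)) :=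
      continuous_comp_exp_of_differentiableOn hF (by fun_prop) fun x => by simp
    exact h1.mul (by fun_prop)
  have hsub : ∀ θ : ℝ, F (Complex.exp (-(1 : ℝ) + θ * Complex.I) ^ 2) *
      Complex.exp ((2 * n : ℕ) * ((1 : ℝ) - θ * Complex.I)) = g (2 * θ) := by
    intro θ
    rw [← Complex.exp_nat_mul]
    simp only [hg]
    congr 2
    · congr 1; push_cast; ring
    · push_cast; ring
  have hdouble := hper.intervalIntegral_add_zsmul_eq 2 (-(2 * π))
    fun a b => hcont.intervalIntegrable a b
  have hshift := hper.intervalIntegral_add_eq (-(2 * π)) (-π)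
  rw [hshift, show -(2 * π) + (2 : ℤ) • (2 * π) = 2 * π by simp; ring,
    show -π + 2 * π = π by ring] at hdouble
  rw [taylorCoeff_eq_integral hG (2 * n) one_pos, taylorCoeff_eq_integral hF n two_pos]
  simp_rw [hsub]
  rw [intervalIntegral.integral_comp_mul_left _ two_ne_zero, mul_neg, hdouble]
  simp [hg]

/-! ### Identification with the q-expansion coefficients -/

theorem etaQuotientH_eq (α β : ℤ) (τ : ℍ) :
    etaQuotientH α β τ = etaQuotientDisc α β (Function.Periodic.qParam 1 τ) := by
  have e : ∀ z : ℂ, Function.Periodic.qParam 24 z = Complex.exp (2 * π * Complex.I * z / 24) := by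
    intro z; simp [Function.Periodic.qParam]
  have e2 : Function.Periodic.qParam 1 (2 * (τ : ℂ)) = Function.Periodic.qParam 1 (τ : ℂ) ^ 2 := by
    rw [Function.Periodic.qParam, Function.Periodic.qParam, ← Complex.exp_nat_mul]
    congr 1; push_cast; ring
  rw [etaQuotientH, etaQuotientDisc, eta_eq_qParam_mul_eulerProd, eta_eq_qParam_mul_eulerProd, e2,
    mul_zpow, mul_zpow, e, e, ← Complex.exp_int_mul, ← Complex.exp_int_mul]
  have h1 : Complex.exp (2 * π * Complex.I * (τ : ℂ) * (-((α : ℂ) + 2 * β) / 24)) *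
      Complex.exp (α * (2 * π * Complex.I * (τ : ℂ) / 24)) *
      Complex.exp (β * (2 * π * Complex.I * (2 * (τ : ℂ)) / 24)) = 1 := by
    rw [← Complex.exp_add, ← Complex.exp_add, Complex.exp_eq_one_iff]
    exact ⟨0, by push_cast; ring⟩
  linear_combination (eulerProd (Function.Periodic.qParam 1 (τ : ℂ)) ^ α *
    eulerProd (Function.Periodic.qParam 1 (τ : ℂ) ^ 2) ^ β) * h1

theorem cuspFunction_etaQuotientH_eqOn (α β : ℤ) :
    Set.EqOn (UpperHalfPlane.cuspFunction 1 (etaQuotientH α β)) (etaQuotientDisc α β)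
      (Metric.ball 0 1) := by
  have hne : ∀ q ∈ Metric.ball (0 : ℂ) 1, q ≠ 0 →
      UpperHalfPlane.cuspFunction 1 (etaQuotientH α β) q = etaQuotientDisc α β q := by
    intro q hq hq0
    have him := Function.Periodic.im_invQParam_pos_of_norm_lt_one one_pos (by simpa using hq) hq0
    rw [UpperHalfPlane.cuspFunction, Function.Periodic.cuspFunction_eq_of_nonzero 1 _ hq0,
      Function.comp_apply, UpperHalfPlane.ofComplex_apply_of_im_pos him, etaQuotientH_eq]
    exact congrArg _ (Function.Periodic.qParam_right_inv one_ne_zero hq0)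
  intro q hq
  rcases eq_or_ne q 0 with rfl | hq0
  -- At q = 0 the cusp function is a punctured limit, identified by continuity on the disc.
  · have hball : Metric.ball (0 : ℂ) 1 ∈ 𝓝 0 := Metric.ball_mem_nhds 0 one_pos
    have hc := ((differentiableOn_etaQuotientDisc α β).differentiableAt hball).continuousAt.tendsto
    rw [UpperHalfPlane.cuspFunction, Function.Periodic.cuspFunction_zero_eq_limUnder_nhds_ne]
    refine Tendsto.limUnder_eq ?_
    refine (hc.mono_left nhdsWithin_le_nhds).congr' ?_
    filter_upwards [self_mem_nhdsWithin, nhdsWithin_le_nhds hball] with z hz hz1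
    exact (hne z hz1 hz).symm
  · exact hne q hq hq0

theorem etaQuotientCoeff_eq_taylorCoeff (α β : ℤ) (n : ℕ) :
    etaQuotientCoeff α β n = taylorCoeff (etaQuotientDisc α β) n := by
  rw [etaQuotientCoeff, UpperHalfPlane.qExpansion_coeff, taylorCoeff]
  congr 1
  exact Filter.EventuallyEq.iteratedDeriv_eq n
    ((cuspFunction_etaQuotientH_eqOn α β).eventuallyEq_of_mem (Metric.ball_mem_nhds 0 one_pos))

/-! ### Explicit constants and the three cases -/

theorem sqrt_zpow_eq_exp {x : ℝ} (hx : 0 < x) (a : ℤ) :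
    √x ^ a = Real.exp (Real.log x * (a / 2)) := by
  rw [Real.sqrt_eq_rpow, Real.rpow_def_of_pos hx, exp_zpow]
  congr 1; ring

theorem inv_two_mul_sqrt_pi : (2 * √π)⁻¹ = Real.exp (-(Real.log 2 + Real.log π / 2)) := by
  rw [Real.exp_neg, Real.exp_add, Real.exp_log two_pos, ← Real.log_sqrt Real.pi_pos.le,
    Real.exp_log (Real.sqrt_pos.2 Real.pi_pos)]

theorem two_mul_sqrt_sq_mul (x : ℝ) {y : ℝ} (hxy : 4 * x = π ^ 2 * y) : 2 * √x = π * √y := by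
  have h4 : √(4 : ℝ) = 2 := by
    rw [show (4 : ℝ) = 2 ^ 2 by norm_num]; exact Real.sqrt_sq two_pos.le
  rw [← h4, ← Real.sqrt_mul (by norm_num), hxy, Real.sqrt_mul (by positivity),
    Real.sqrt_sq Real.pi_pos.le]

/-- Positivity of A comes from 2α + β = α + (α + β) < 0. -/
theorem taylorCoeff_etaQuotientDisc_isEquivalent {α β : ℤ} (hα : α < 0) (hαβ : α + β ≤ 0) :
    (fun n : ℕ => taylorCoeff (etaQuotientDisc α β) n) ~[atTop] fun n : ℕ =>
      (((2 : ℝ) ^ ((2 * (α : ℝ) + β - 3) / 2) * (3 : ℝ) ^ (((α : ℝ) + β - 1) / 4) *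
        (-(2 * (α : ℝ) + β)) ^ ((-(α : ℝ) - β + 1) / 4) * (n : ℝ) ^ (((α : ℝ) + β - 3) / 4) *
        Real.exp (π * √(-(2 * (α : ℝ) + β) / 3 * n)) : ℝ) : ℂ) := by
  have hD : 0 < -(2 * (α : ℝ) + β) := by
    have : (0 : ℤ) < -(2 * α + β) := by omega
    exact_mod_cast this
  have hpi := Real.pi_pos
  have hA : 0 < -(π ^ 2 * (4 * α + 2 * β + (0 : ℤ)) / 24) := by
    have : 0 < π ^ 2 * -(2 * (α : ℝ) + β) := by positivity
    push_cast
    linarith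
  have hmaj : Tendsto (fun w : ℂ => etaQuotientDisc α β (Complex.exp (-w)) /
      (w ^ (((-(α + β + (0 : ℤ)) / 2 : ℝ)) : ℂ) *
        Complex.exp ((-(π ^ 2 * (4 * α + 2 * β + (0 : ℤ)) / 24) : ℝ) / w))) (𝓝[stolzSector] 0)
      (𝓝 ((√(2 * π) ^ α * √π ^ β * √(π / 2) ^ (0 : ℤ) : ℝ) : ℂ)) := by
    refine (tendsto_eulerProd_quotient α β 0).congr fun w => ?_
    rw [zpow_zero, mul_one, etaQuotientDisc]
  have hmin := exists_minorArc_bound (F := etaQuotientDisc α β) (k := -α / 4)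
    (by have : (α : ℝ) < 0 := by exact_mod_cast hα
        linarith) fun q hq => by
      refine (norm_etaQuotientDisc_le hq hα.le hαβ).trans_eq ?_
      congr 2; ring
  have hC : ((√(2 * π) ^ α * √π ^ β * √(π / 2) ^ (0 : ℤ) : ℝ) : ℂ) ≠ 0 := by
    have : 0 < √(2 * π) ^ α * √π ^ β * √(π / 2) ^ (0 : ℤ) := by positivity
    exact_mod_cast this.ne'
  refine (taylorCoeff_isEquivalent (differentiableOn_etaQuotientDisc α β) hA hC hmaj
    hmin).congr_right (.of_forall fun n => ?_)
  simp only
  rw [← Complex.ofReal_mul]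
  congr 1
  have hn : (n : ℝ) ^ (-(-(α + β + (0 : ℤ)) / 2) / 2 - 3 / 4 : ℝ) =
      (n : ℝ) ^ (((α : ℝ) + β - 3) / 4) := by
    congr 1; push_cast; ring
  have hexp : 2 * √(-(π ^ 2 * (4 * α + 2 * β + (0 : ℤ)) / 24) * n) =
      π * √(-(2 * (α : ℝ) + β) / 3 * n) := two_mul_sqrt_sq_mul _ (by push_cast; ring)
  have hlogA : Real.log (-(π ^ 2 * (4 * α + 2 * β + (0 : ℤ)) / 24)) =
      2 * Real.log π + Real.log (-(2 * (α : ℝ) + β)) - (2 * Real.log 2 + Real.log 3) := by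
    rw [show -(π ^ 2 * (4 * α + 2 * β + (0 : ℤ)) / 24) =
      π ^ 2 * (-(2 * (α : ℝ) + β)) / (2 ^ 2 * 3) by push_cast; ring,
      Real.log_div (by positivity) (by positivity), Real.log_mul (by positivity) hD.ne',
      Real.log_mul (by positivity) (by positivity), Real.log_pow, Real.log_pow]
    norm_num
  -- In logarithms this is linear in log 2, log 3, log π and log(-(2α+β)); the powers of π cancel.
  have hconst : √(2 * π) ^ α * √π ^ β * √(π / 2) ^ (0 : ℤ) * ((2 * √π)⁻¹ *
      (-(π ^ 2 * (4 * α + 2 * β + (0 : ℤ)) / 24)) ^ (-(α + β + (0 : ℤ)) / 2 / 2 + 1 / 4 : ℝ)) =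
      (2 : ℝ) ^ ((2 * (α : ℝ) + β - 3) / 2) * (3 : ℝ) ^ (((α : ℝ) + β - 1) / 4) *
        (-(2 * (α : ℝ) + β)) ^ ((-(α : ℝ) - β + 1) / 4) := by
    rw [sqrt_zpow_eq_exp (by positivity), sqrt_zpow_eq_exp hpi, inv_two_mul_sqrt_pi, zpow_zero,
      Real.rpow_def_of_pos hA, hlogA, Real.rpow_def_of_pos two_pos,
      Real.rpow_def_of_pos three_pos, Real.rpow_def_of_pos hD, mul_one, ← Real.exp_add,
      ← Real.exp_add, ← Real.exp_add, ← Real.exp_add, ← Real.exp_add,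
      Real.log_mul two_ne_zero hpi.ne']
    congr 1; push_cast; ring
  rw [hn, hexp, ← hconst]
  ring

theorem etaQuotientDisc_neg {q : ℂ} (hq : ‖q‖ < 1) (α β : ℤ) :
    etaQuotientDisc α β (-q) =
      eulerProd q ^ (-α) * eulerProd (q ^ 2) ^ (3 * α + β) * eulerProd (q ^ 4) ^ (-α) := by
  rw [etaQuotientDisc, eulerProd_neg hq, neg_sq,
    zpow_add₀ (eulerProd_ne_zero (norm_sq_lt_one hq)), div_zpow, mul_zpow, zpow_mul, zpow_neg,
    zpow_neg, div_eq_mul_inv, mul_inv]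
  norm_cast
  ring

/-- F(-q) has exponents (-α, 3α+β, -α) at E(q), E(q²), E(q⁴). Hence κ = -(α+β)/2 again, and A =
-π²(α+2β)/24, positive since α + 2β = 2(α + β) - α < 0. -/
theorem taylorCoeff_etaQuotientDisc_isEquivalent_of_pos {α β : ℤ} (hα : 0 < α)
    (hαβ : α + β ≤ 0) :
    (fun n : ℕ => taylorCoeff (etaQuotientDisc α β) n) ~[atTop] fun n : ℕ =>
      (((-1 : ℝ) ^ n * (2 : ℝ) ^ ((3 * (α : ℝ) + 3 * β - 7) / 4) *
        (3 : ℝ) ^ (((α : ℝ) + β - 1) / 4) *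
        (-((α : ℝ) + 2 * β)) ^ ((1 - (α : ℝ) - β) / 4) * (n : ℝ) ^ (((α : ℝ) + β - 3) / 4) *
        Real.exp (π * √(-((α : ℝ) + 2 * β) / 6 * n)) : ℝ) : ℂ) := by
  have hD : 0 < -((α : ℝ) + 2 * β) := by
    have : (0 : ℤ) < -(α + 2 * β) := by omega
    exact_mod_cast this
  have hpi := Real.pi_pos
  have hA : 0 < -(π ^ 2 * (4 * (-α : ℤ) + 2 * (3 * α + β : ℤ) + (-α : ℤ)) / 24) := by
    have : 0 < π ^ 2 * -((α : ℝ) + 2 * β) := by positivity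
    push_cast
    linarith
  have hmaj : Tendsto (fun w : ℂ => etaQuotientDisc α β (-Complex.exp (-w)) /
      (w ^ (((-((-α : ℤ) + (3 * α + β : ℤ) + (-α : ℤ)) / 2 : ℝ)) : ℂ) *
        Complex.exp ((-(π ^ 2 * (4 * (-α : ℤ) + 2 * (3 * α + β : ℤ) + (-α : ℤ)) / 24) : ℝ) / w)))
      (𝓝[stolzSector] 0)
      (𝓝 ((√(2 * π) ^ (-α) * √π ^ (3 * α + β) * √(π / 2) ^ (-α) : ℝ) : ℂ)) := by
    refine (tendsto_eulerProd_quotient (-α) (3 * α + β) (-α)).congr' ?_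
    filter_upwards [self_mem_nhdsWithin] with w hw
    rw [etaQuotientDisc_neg (by simpa [Complex.norm_exp] using hw.1)]
  have hmin := exists_minorArc_bound (F := fun q => etaQuotientDisc α β (-q)) (k := α / 4)
    (by have : (0 : ℝ) < α := by exact_mod_cast hα
        linarith) fun q hq => by
      refine (norm_etaQuotientDisc_neg_le hq hα.le hαβ).trans_eq ?_
      congr 2; ring
  have hC : ((√(2 * π) ^ (-α) * √π ^ (3 * α + β) * √(π / 2) ^ (-α) : ℝ) : ℂ) ≠ 0 := by
    have : 0 < √(2 * π) ^ (-α) * √π ^ (3 * α + β) * √(π / 2) ^ (-α) := by positivity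
    exact_mod_cast this.ne'
  have hdiff : DifferentiableOn ℂ (fun q => etaQuotientDisc α β (-q)) (Metric.ball 0 1) :=
    (differentiableOn_etaQuotientDisc α β).comp (by fun_prop) fun q hq => by simpa using hq
  have h := (taylorCoeff_isEquivalent hdiff hA hC hmaj hmin)
  have hsign := (IsEquivalent.refl (u := fun n : ℕ => ((-1 : ℂ)) ^ n) (l := atTop)).mul h
  refine (hsign.congr_left (.of_forall fun n => ?_)).congr_right (.of_forall fun n => ?_)
  · simp only [Pi.mul_apply]
    rw [taylorCoeff_comp_neg, ← mul_assoc, ← mul_pow]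
    simp
  simp only [Pi.mul_apply]
  rw [← Complex.ofReal_mul, show ((-1 : ℂ) ^ n) = (((-1 : ℝ) ^ n : ℝ) : ℂ) by push_cast; rfl,
    ← Complex.ofReal_mul]
  congr 1
  have hn : (n : ℝ) ^ (-(-((-α : ℤ) + (3 * α + β : ℤ) + (-α : ℤ)) / 2) / 2 - 3 / 4 : ℝ) =
      (n : ℝ) ^ (((α : ℝ) + β - 3) / 4) := by
    congr 1; push_cast; ring
  have hexp : 2 * √(-(π ^ 2 * (4 * (-α : ℤ) + 2 * (3 * α + β : ℤ) + (-α : ℤ)) / 24) * n) =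
      π * √(-((α : ℝ) + 2 * β) / 6 * n) := two_mul_sqrt_sq_mul _ (by push_cast; ring)
  have hlogA : Real.log (-(π ^ 2 * (4 * (-α : ℤ) + 2 * (3 * α + β : ℤ) + (-α : ℤ)) / 24)) =
      2 * Real.log π + Real.log (-((α : ℝ) + 2 * β)) - (3 * Real.log 2 + Real.log 3) := by
    rw [show -(π ^ 2 * (4 * (-α : ℤ) + 2 * (3 * α + β : ℤ) + (-α : ℤ)) / 24) =
      π ^ 2 * (-((α : ℝ) + 2 * β)) / (2 ^ 3 * 3) by push_cast; ring,
      Real.log_div (by positivity) (by positivity), Real.log_mul (by positivity) hD.ne',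
      Real.log_mul (by positivity) (by positivity), Real.log_pow, Real.log_pow]
    norm_num
  have hconst : √(2 * π) ^ (-α) * √π ^ (3 * α + β) * √(π / 2) ^ (-α) * ((2 * √π)⁻¹ *
      (-(π ^ 2 * (4 * (-α : ℤ) + 2 * (3 * α + β : ℤ) + (-α : ℤ)) / 24)) ^
        (-((-α : ℤ) + (3 * α + β : ℤ) + (-α : ℤ)) / 2 / 2 + 1 / 4 : ℝ)) =
      (2 : ℝ) ^ ((3 * (α : ℝ) + 3 * β - 7) / 4) * (3 : ℝ) ^ (((α : ℝ) + β - 1) / 4) *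
        (-((α : ℝ) + 2 * β)) ^ ((1 - (α : ℝ) - β) / 4) := by
    rw [sqrt_zpow_eq_exp (by positivity), sqrt_zpow_eq_exp hpi, sqrt_zpow_eq_exp (by positivity),
      inv_two_mul_sqrt_pi, Real.rpow_def_of_pos hA, hlogA, Real.rpow_def_of_pos two_pos,
      Real.rpow_def_of_pos three_pos, Real.rpow_def_of_pos hD, ← Real.exp_add,
      ← Real.exp_add, ← Real.exp_add, ← Real.exp_add, ← Real.exp_add, ← Real.exp_add,
      Real.log_mul two_ne_zero hpi.ne', Real.log_div hpi.ne' two_ne_zero]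
    congr 1; push_cast; ring
  rw [hn, hexp, mul_assoc ((-1 : ℝ) ^ n), mul_assoc ((-1 : ℝ) ^ n), ← hconst]
  ring

theorem etaQuotientDisc_zero_left (β : ℤ) :
    etaQuotientDisc 0 β = fun q => etaQuotientDisc β 0 (q ^ 2) := by
  ext q
  simp [etaQuotientDisc]

theorem corollary6p2 (α β : ℤ) (hαβ : α + β ≤ 0) :
    (α = 0 → β ≠ 0 →
      (fun n : ℕ => etaQuotientCoeff 0 β (2 * n)) ~[atTop] fun n : ℕ =>
        (((2 : ℝ) ^ ((3 * (β : ℝ) - 5) / 4) * (3 : ℝ) ^ (((β : ℝ) - 1) / 4) *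
          (-(β : ℝ)) ^ ((1 - (β : ℝ)) / 4) * (n : ℝ) ^ (((β : ℝ) - 3) / 4) *
          Real.exp (π * √(-2 * (β : ℝ) / 3 * n)) : ℝ) : ℂ)) ∧
    (α < 0 →
      (fun n : ℕ => etaQuotientCoeff α β n) ~[atTop] fun n : ℕ =>
        (((2 : ℝ) ^ ((2 * (α : ℝ) + β - 3) / 2) * (3 : ℝ) ^ (((α : ℝ) + β - 1) / 4) *
          (-(2 * (α : ℝ) + β)) ^ ((-(α : ℝ) - β + 1) / 4) * (n : ℝ) ^ (((α : ℝ) + β - 3) / 4) *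
          Real.exp (π * √(-(2 * (α : ℝ) + β) / 3 * n)) : ℝ) : ℂ)) ∧
    (0 < α →
      (fun n : ℕ => etaQuotientCoeff α β n) ~[atTop] fun n : ℕ =>
        (((-1 : ℝ) ^ n * (2 : ℝ) ^ ((3 * (α : ℝ) + 3 * β - 7) / 4) *
          (3 : ℝ) ^ (((α : ℝ) + β - 1) / 4) *
          (-((α : ℝ) + 2 * β)) ^ ((1 - (α : ℝ) - β) / 4) * (n : ℝ) ^ (((α : ℝ) + β - 3) / 4) *
          Real.exp (π * √(-((α : ℝ) + 2 * β) / 6 * n)) : ℝ) : ℂ)) := by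
  refine ⟨fun hα hβ => ?_, fun hα => ?_, fun hα => ?_⟩
  · have hβ' : β < 0 := by omega
    simp_rw [etaQuotientCoeff_eq_taylorCoeff, etaQuotientDisc_zero_left,
      taylorCoeff_comp_sq (differentiableOn_etaQuotientDisc β 0)]
    refine (taylorCoeff_etaQuotientDisc_isEquivalent (β := 0) hβ' (by omega)).congr_right
      (.of_forall fun n => ?_)
    have hD : 0 < -(β : ℝ) := by
      have : (β : ℝ) < 0 := by exact_mod_cast hβ'
      linarith
    simp only [Int.cast_zero, add_zero, sub_zero]
    congr 1
    -- The factor 2 in -(2β) is absorbed into the power of 2.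
    have h : (2 : ℝ) ^ ((2 * (β : ℝ) - 3) / 2) * (-(2 * (β : ℝ))) ^ ((-(β : ℝ) + 1) / 4) =
        (2 : ℝ) ^ ((3 * (β : ℝ) - 5) / 4) * (-(β : ℝ)) ^ ((1 - (β : ℝ)) / 4) := by
      rw [show -(2 * (β : ℝ)) = 2 * -(β : ℝ) by ring, Real.mul_rpow two_pos.le hD.le, ← mul_assoc,
        ← Real.rpow_add two_pos]
      congr 2 <;> ring
    rw [mul_right_comm ((2 : ℝ) ^ ((2 * (β : ℝ) - 3) / 2)), h, neg_mul]
    ring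
  · simp_rw [etaQuotientCoeff_eq_taylorCoeff]
    exact taylorCoeff_etaQuotientDisc_isEquivalent hα hαβ
  · simp_rw [etaQuotientCoeff_eq_taylorCoeff]
    exact taylorCoeff_etaQuotientDisc_isEquivalent_of_pos hα hαβ
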